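/- Let $F$ be a field of characteristic $0$ and let $q=(q_1,\dots,q_k)$ be a composition of $n\ge 0$ (a finite sequence of positive integers with sum $n$). Permutations of $\{1,\dots,n\}$ are multiplied from left to right, $(i)(\sigma\tau)=((i)\sigma)\tau$, and modules for the group algebra $F\mathfrak S_n$ are right modules. Let $\Xi^q\in F\mathfrak S_n$ be the sum of all $\sigma\in\mathfrak S_n$ whose descent set $\{i\in[1,n-1] : (i)\sigma>(i+1)\sigma\}$ is contained in $\{q_1+\cdots+q_j : 1\le j\le k\}$, and let $X^q_F=\Xi^qF\mathfrak S_n$. For $m\ge 0$ let $\omega_m=(1-c_m)(1-c_{m-1})\cdots(1-c_2)\in F\mathfrak S_m$, where $c_i$ is the cycle $(i,i-1,\dots,1)$. Let $\omega^q\in F\mathfrak S_n$ be the product of the elements obtained from $\omega_{q_1},\dots,\omega_{q_k}$ by letting $\omega_{q_j}$ act on the $j$-th block $\{q_1+\cdots+q_{j-1}+1,\dots,q_1+\cdots+q_j\}$. The higher Lie module of $q$ is the right ideal $\mathrm{Lie}_F(q)=\omega_qF\mathfrak S_n$, where $\omega_q=\omega^q\Xi^q$. A partition of $n$ is a composition of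 $n$ with weakly decreasing parts. For a partition $\lambda$ of $n$ write $\lambda\preccurlyeq q$ if $\lambda$ is a weak refinement of $q$, i.e. if some rearrangement of the parts of $\lambda$ can be cut into $k$ consecutive pieces with sums $q_1,\dots,q_k$, in this order. Then there is an isomorphism of $F\mathfrak S_n$-modules $$X^q_F\;\cong\;\bigoplus_{\lambda\vdash n,\ \lambda\preccurlyeq q}\mathrm{Lie}_F(\lambda).$$ Consequently, for every simple $F\mathfrak S_n$-module $S$ (such as the Specht modules), the multiplicity of $S$ in $X^q_F$ is the sum, over the partitions $\lambda$ of $n$ with $\lambda\preccurlyeq q$, of the multiplicities of $S$ in $\mathrm{Lie}_F(\lambda)$. -/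

import Mathlib

open scoped DirectSum

noncomputable section

/-!
Conventions. Permutations are often multiplied from left to right when one works with the descent
algebra: `(i)(σ · τ) = ((i)σ)τ`. Mathlib multiplies them from right to left, so `σ · τ` is
`τ * σ` here. Every product below is therefore written in reverse order; the right ideal
`x · F𝔖ₙ = {x · a}` of the left-to-right group algebra is the left ideal `{a * x}` of Mathlib's
group algebra, and right modules over the former are the same thing as left modules over the latter.
A permutation `σ` is identified with the word `σ 0, σ 1, …, σ (n - 1)` (letters from `0`).
-/

namespace HigherLie

/-- The group algebra of the symmetric group on `n` letters. -/
abbrev SymAlg (F : Type*) [CommRing F] (n : ℕ) : Type _ :=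
  MonoidAlgebra F (Equiv.Perm (Fin n))

section Compositions

variable {n : ℕ}

/-- `r` is a (strong) refinement of `q`: the sequence `r` can be cut into consecutive pieces whose
sums are the parts of `q`, in order. -/
def IsRefinement (r q : Composition n) : Prop :=
  ∃ L : List (List ℕ), L.flatten = r.blocks ∧ L.map List.sum = q.blocks

/-- `r` is a weak refinement of `q`: some rearrangement of `r` is a refinement of `q`. -/
def IsWeakRefinement (r q : Composition n) : Prop :=
  ∃ s : Composition n, r.blocks.Perm s.blocks ∧ IsRefinement s q

/-- A partition of `n` is a composition of `n` whose parts are weakly decreasing. -/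
def IsPartition (r : Composition n) : Prop :=
  r.blocks.Pairwise (fun a b => b ≤ a)

open Classical in
/-- The finite set of all partitions of `n` that are weak refinements of `q`. -/
def weakRefiningPartitions (q : Composition n) : Finset (Composition n) :=
  Finset.univ.filter fun l => IsPartition l ∧ IsWeakRefinement l q

/-- The descent set of a permutation, as a set of positions counted from `1`: the number `i + 1`
is a descent if the letter at position `i + 1` exceeds the one at position `i + 2`, i.e. if
`σ i > σ (i + 1)` when positions are counted from `0`. -/
def descentSet (σ : Equiv.Perm (Fin n)) : Set ℕ :=
  {d | ∃ (i : ℕ) (h : i + 1 < n), d = i + 1 ∧ σ ⟨i + 1, h⟩ < σ ⟨i, Nat.lt_of_succ_lt h⟩}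

/-- The partial sums `q₁, q₁ + q₂, …, q₁ + ⋯ + q_k` of a composition. -/
def partialSums (q : Composition n) : Set ℕ :=
  {d | ∃ i : ℕ, 1 ≤ i ∧ i ≤ q.length ∧ d = q.sizeUpTo i}

end Compositions

section Elements

variable (F : Type*) [CommRing F] {n : ℕ}

open Classical in
/-- Solomon's descent element `Ξ^q`: the sum of all permutations whose descents are partial sums
of `q`. -/
def Xi (q : Composition n) : SymAlg F n :=
  ∑ σ : Equiv.Perm (Fin n) with descentSet σ ⊆ partialSums q,
    MonoidAlgebra.of F (Equiv.Perm (Fin n)) σ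

/-- The Dynkin-Specht-Wever element `ω_m = (1 - c_m) · (1 - c_{m-1}) ⋯ (1 - c_2)`, where `c_i` is
the descending cycle `(i, i-1, …, 1)`. As `Fin.cycleRange i` is the cycle `(0 1 … i)`, its inverse
is `c_{i+1}` on letters counted from `0`; here `i` runs through `1, …, m - 1`. -/
def omega (m : ℕ) : SymAlg F m :=
  ((List.finRange m).tail.map fun i =>
    1 - MonoidAlgebra.of F (Equiv.Perm (Fin m)) (Fin.cycleRange i)⁻¹).prod

/-- `ω^q`: the product over the blocks of `q` of the Dynkin-Specht-Wever elements of these blocks,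
each acting on its own block of consecutive letters. The factors commute with each other. -/
def omegaUp (q : Composition n) : SymAlg F n :=
  (List.ofFn fun j : Fin q.length =>
    MonoidAlgebra.mapDomainAlgHom F F
      (Equiv.Perm.viaEmbeddingHom (q.embedding j).toEmbedding) (omega F (q.blocksFun j))).prod

/-- The higher Lie element `ω_q = ω^q · Ξ^q` (product from left to right). -/
def omegaLow (q : Composition n) : SymAlg F n :=
  Xi F q * omegaUp F q

/-- The module `X^q_F = Ξ^q · F𝔖ₙ` (product from left to right). -/
abbrev XiModule (q : Composition n) : Submodule (SymAlg F n) (SymAlg F n) :=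
  Submodule.span (SymAlg F n) {Xi F q}

/-- The higher Lie module `Lie_F(q) = ω_q · F𝔖ₙ` (product from left to right). -/
abbrev LieModule (q : Composition n) : Submodule (SymAlg F n) (SymAlg F n) :=
  Submodule.span (SymAlg F n) {omegaLow F q}

end Elements

/-- The multiplicity of a simple module `S` in a semisimple module `M`: the number of simple
summands of the `S`-isotypic component of `M`, i.e. its length. -/
def multiplicity (A S M : Type*) [Ring A] [AddCommGroup S] [Module A S]
    [AddCommGroup M] [Module A M] : ℕ∞ :=
  Module.length A (isotypicComponent A M S)

end HigherLie

end

/-! Elements of the group algebra become operators on the free associative algebra. Under `wordMap`,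
right multiplication by `Xi F q` turns into `degConv`, the convolution of homogeneous projections,
and right multiplication by `omegaLow F q` into `dynkinConv`, the convolution of Dynkin operators
(`wordMap_mul_Xi`, `wordMap_mul_omegaLow`). Both can be evaluated on products of Lie elements: these
are primitive, so the coproduct just distributes the factors over the tensor slots
(`convolution_prod`).

Such products are filtered by the number of factors, and exchanging two neighbours costs only a
product with one factor fewer, their commutator. Modulo fewer factors, `degConv` multiplies a
product of Lie elements of degrees `d` by the number of ways to distribute the parts of `d` over
those of `q`; it is exactly zero if there are none, that is, if `d` is not a weak refinement of `q`.
A `dynkinConv` with `k` slots kills products of fewer than `k` factors, and of `k` factors with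
other degrees; on matching degrees it is a nonzero scalar modulo fewer factors.

Hence, for partitions, `omegaLow r * Xi q * omegaLow s` vanishes if `r ≠ s` and `r` is not longer
than `s`, while for `r = s` it is a multiple of `omegaLow r`, nonzero if `r` weakly refines `q`;
otherwise already `omegaLow r * Xi q = 0`. Moreover the `omegaLow r` generate the whole group
algebra (`iSup_lieModule_eq_top`). So right multiplication by `Xi q` maps the direct sum of the
higher Lie modules onto the module of `q`, and triangularity makes it injective
(`nonempty_span_equiv_directSum`). -/

noncomputable section

namespace HigherLie

open Module

/-! ### The free associative algebra and its basis of words -/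

section Words

variable {F : Type*} [CommRing F]

/-- The monomial basis of a monoid algebra. -/
def monomialBasis (F M : Type*) [CommRing F] : Basis M F (MonoidAlgebra F M) :=
  Basis.ofRepr (MonoidAlgebra.coeffLinearEquiv F)

@[simp]
theorem monomialBasis_apply {M : Type*} (m : M) :
    monomialBasis F M m = MonoidAlgebra.single m 1 := rfl

/-- The linear extension of a map defined on the monomials of a monoid algebra. -/
def linearExtend (F : Type*) [CommRing F] {M N : Type*} [AddCommGroup N] [Module F N]
    (f : M → N) : MonoidAlgebra F M →ₗ[F] N :=
  (monomialBasis F M).constr F f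

@[simp]
theorem linearExtend_single {M N : Type*} [AddCommGroup N] [Module F N] (f : M → N) (m : M) :
    linearExtend F f (MonoidAlgebra.single m 1) = f m := by
  rw [← monomialBasis_apply, linearExtend, Basis.constr_basis]

theorem linearMap_ext_single {M N : Type*} [AddCommGroup N] [Module F N]
    {f g : MonoidAlgebra F M →ₗ[F] N}
    (h : ∀ m, f (MonoidAlgebra.single m 1) = g (MonoidAlgebra.single m 1)) : f = g :=
  (monomialBasis F M).ext h

/-- The free associative algebra on `X`, spanned by words. -/
abbrev WordAlg (F X : Type*) [CommRing F] : Type _ := MonoidAlgebra F (FreeMonoid X)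

variable {X : Type*}

/-- A word as an element of the free associative algebra. -/
def word (F : Type*) [CommRing F] {X : Type*} (w : List X) : WordAlg F X :=
  MonoidAlgebra.single (FreeMonoid.ofList w) 1

theorem word_nil : word F ([] : List X) = 1 := rfl

theorem word_append (u v : List X) : word F (u ++ v) = word F u * word F v := by
  simp [word, MonoidAlgebra.single_mul_single, FreeMonoid.ofList_append]

theorem word_cons (x : X) (v : List X) : word F (x :: v) = word F [x] * word F v :=
  word_append [x] v

theorem word_flatten (L : List (List X)) : word F L.flatten = (L.map (word F)).prod := by
  induction L with
  | nil => rfl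
  | cons a L ih => simp [word_append, ih]

theorem word_eq_prod (w : List X) : word F w = (w.map fun x => word F [x]).prod := by
  induction w with
  | nil => rfl
  | cons a L ih => rw [word_cons, ih]; simp

theorem linearExtend_word {N : Type*} [AddCommGroup N] [Module F N] (f : FreeMonoid X → N)
    (w : List X) : linearExtend F f (word F w) = f (FreeMonoid.ofList w) :=
  linearExtend_single _ _

theorem wordAlg_ext {N : Type*} [AddCommGroup N] [Module F N] {f g : WordAlg F X →ₗ[F] N}
    (h : ∀ w : List X, f (word F w) = g (word F w)) : f = g :=
  linearMap_ext_single fun m => h (FreeMonoid.toList m)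

theorem span_range_word : Submodule.span F (Set.range (word F : List X → WordAlg F X)) = ⊤ :=
  (monomialBasis F (FreeMonoid X)).span_eq

end Words

/-! ### Tensor powers and the coproduct with primitive letters -/

section Coproduct

variable (F : Type*) [CommRing F] (X : Type*) (k : ℕ)

/-- The `k`-fold tensor power of the free associative algebra. -/
abbrev WordTensor : Type _ := MonoidAlgebra F (Fin k → FreeMonoid X)

variable {X k}

/-- The embedding of the free associative algebra as the `j`-th tensor factor. -/
def slot (j : Fin k) : WordAlg F X →ₐ[F] WordTensor F X k :=
  MonoidAlgebra.mapDomainAlgHom F F (MonoidHom.mulSingle (fun _ : Fin k => FreeMonoid X) j)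

variable (X k) in
/-- The `k`-fold coproduct for which the letters are primitive. -/
def coproduct : WordAlg F X →ₐ[F] WordTensor F X k :=
  MonoidAlgebra.lift F _ (FreeMonoid X) (FreeMonoid.lift fun x => ∑ j, slot F j (word F [x]))

variable {F}

theorem slot_single (j : Fin k) (w : FreeMonoid X) :
    slot F j (MonoidAlgebra.single w 1) = MonoidAlgebra.single (Pi.mulSingle j w) 1 := by
  simp [slot]

theorem coproduct_letter (x : X) :
    coproduct F X k (word F [x]) = ∑ j, slot F j (word F [x]) := by
  rw [coproduct, word, MonoidAlgebra.lift_single, one_smul]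
  exact FreeMonoid.lift_eval_of _ _

theorem slot_commute {i j : Fin k} (h : i ≠ j) (a b : WordAlg F X) :
    Commute (slot F i a) (slot F j b) := by
  induction a using MonoidAlgebra.induction_on with
  | of m =>
    induction b using MonoidAlgebra.induction_on with
    | of m' =>
      simp only [MonoidAlgebra.of_apply, slot_single]
      exact MonoidAlgebra.single_commute_single (Pi.mulSingle_commute h _ _) (Commute.all _ _)
    | add x y hx hy => rw [map_add]; exact hx.add_right hy
    | smul r x hx => rw [map_smul]; exact hx.smul_right r
  | add x y hx hy => rw [map_add]; exact hx.add_left hy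
  | smul r x hx => rw [map_smul]; exact hx.smul_left r

variable (F X k) in
/-- Pure tensors. -/
def pureTensor : MultilinearMap F (fun _ : Fin k => WordAlg F X) (WordTensor F X k) :=
  (MultilinearMap.mkPiAlgebraFin F k (WordTensor F X k)).compLinearMap
    fun j => (slot F j).toLinearMap

theorem pureTensor_apply (a : Fin k → WordAlg F X) :
    pureTensor F X k a = (List.ofFn fun j => slot F j (a j)).prod := rfl

theorem pureTensor_single (u : Fin k → FreeMonoid X) :
    pureTensor F X k (fun j => MonoidAlgebra.single (u j) 1) = MonoidAlgebra.single u 1 := by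
  rw [pureTensor_apply]
  simp only [slot_single]
  have h : (List.ofFn fun j => (MonoidAlgebra.single (Pi.mulSingle j (u j)) 1 : WordTensor F X k))
      = (List.ofFn fun j => Pi.mulSingle j (u j)).map (MonoidAlgebra.of F _) := by
    rw [List.map_ofFn]; rfl
  rw [h, ← map_list_prod, MonoidAlgebra.of_apply]
  congr 1
  funext i
  rw [List.ofFn_eq_map, Pi.list_prod_apply, List.map_map,
    List.prod_map_eq_pow_single i _ fun j hj _ => by simp [Pi.mulSingle_eq_of_ne hj.symm],
    List.count_eq_one_of_mem (List.nodup_finRange k) (List.mem_finRange i)]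
  simp

theorem pureTensor_one : pureTensor F X k (fun _ => 1) = 1 := by
  rw [pureTensor_apply]; simp

theorem slot_mul_pureTensor (j : Fin k) (b : WordAlg F X) (a : Fin k → WordAlg F X) :
    slot F j b * pureTensor F X k a =
      pureTensor F X k (Function.update a j (b * a j)) := by
  revert a
  induction b using MonoidAlgebra.induction_on with
  | of m =>
    have h : (LinearMap.mulLeft F (slot F j (MonoidAlgebra.of F _ m))).compMultilinearMap
        (pureTensor F X k) = (pureTensor F X k).compLinearMap
          (fun i => if i = j then LinearMap.mulLeft F (MonoidAlgebra.of F _ m)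
            else LinearMap.id) := by
      refine Basis.ext_multilinear (fun _ => monomialBasis F (FreeMonoid X)) fun v => ?_
      simp only [monomialBasis_apply, LinearMap.compMultilinearMap_apply, LinearMap.mulLeft_apply,
        MultilinearMap.compLinearMap_apply, MonoidAlgebra.of_apply, slot_single, pureTensor_single,
        MonoidAlgebra.single_mul_single, mul_one]
      rw [← pureTensor_single]
      congr 1
      funext i
      by_cases hi : i = j
      · subst hi; simp [MonoidAlgebra.single_mul_single]
      · simp [hi]
    intro a
    refine (DFunLike.congr_fun h a).trans ?_
    rw [MultilinearMap.compLinearMap_apply]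
    congr 1
    funext i
    by_cases hi : i = j
    · subst hi; simp
    · simp [hi]
  | add x y hx hy => intro a; rw [map_add, add_mul, add_mul, MultilinearMap.map_update_add, hx, hy]
  | smul r x hx =>
    intro a; rw [map_smul, smul_mul_assoc, smul_mul_assoc, MultilinearMap.map_update_smul, hx]

/-- Different slots commute, so the factors can be sorted by slot; within one slot their order is
kept. -/
theorem prod_slot_eq_pureTensor {ι : Type*} (f : ι → Fin k) (P : ι → WordAlg F X) (l : List ι) :
    (l.map fun i => slot F (f i) (P i)).prod =
      pureTensor F X k fun j => ((l.filter (f · = j)).map P).prod := by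
  induction l with
  | nil => simp [pureTensor_one]
  | cons a l ih =>
    rw [List.map_cons, List.prod_cons, ih, slot_mul_pureTensor]
    congr 1
    funext j
    by_cases h : f a = j
    · subst h; simp
    · simp [h, Function.update_of_ne (Ne.symm h)]

end Coproduct

/-! ### Convolution of endomorphisms, and primitive elements -/

section Convolution

variable {F : Type*} [CommRing F] {X : Type*} {k : ℕ}

/-- The linear map of the tensor power to the algebra which applies `g j` to the `j`-th factor and
then multiplies. -/
def mulMap (g : Fin k → WordAlg F X →ₗ[F] WordAlg F X) : WordTensor F X k →ₗ[F] WordAlg F X :=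
  linearExtend F fun u => (List.ofFn fun j => g j (MonoidAlgebra.single (u j) 1)).prod

theorem mulMap_pureTensor (g : Fin k → WordAlg F X →ₗ[F] WordAlg F X) (a : Fin k → WordAlg F X) :
    mulMap g (pureTensor F X k a) = (List.ofFn fun j => g j (a j)).prod := by
  have h : (mulMap g).compMultilinearMap (pureTensor F X k) =
      (MultilinearMap.mkPiAlgebraFin F k (WordAlg F X)).compLinearMap g := by
    refine Basis.ext_multilinear (fun _ => monomialBasis F (FreeMonoid X)) fun v => ?_
    simp [pureTensor_single, mulMap]
  simpa using DFunLike.congr_fun h a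

/-- The convolution product of a sequence of linear endomorphisms. -/
def convolution (g : Fin k → WordAlg F X →ₗ[F] WordAlg F X) : WordAlg F X →ₗ[F] WordAlg F X :=
  mulMap g ∘ₗ (coproduct F X k).toLinearMap

/-- An element is primitive for all iterated coproducts. -/
def IsPrimitive (P : WordAlg F X) : Prop := ∀ k, coproduct F X k P = ∑ j, slot F j P

theorem isPrimitive_letter (x : X) : IsPrimitive (word F [x]) := fun _ => coproduct_letter x

/-- The coproduct is multiplicative and each factor is primitive: expanding the product of sums
chooses a slot `f i` for every factor `P i`. -/
theorem convolution_prod (g : Fin k → WordAlg F X →ₗ[F] WordAlg F X) {m : ℕ}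
    (P : Fin m → WordAlg F X) (hP : ∀ i, IsPrimitive (P i)) :
    convolution g (List.ofFn P).prod = ∑ f : Fin m → Fin k,
      (List.ofFn fun j => g j (((List.finRange m).filter (f · = j)).map P).prod).prod := by
  have h : coproduct F X k (List.ofFn P).prod = ∑ f : Fin m → Fin k,
      pureTensor F X k fun j => (((List.finRange m).filter (f · = j)).map P).prod := by
    have h1 := (MultilinearMap.mkPiAlgebraFin F m (WordTensor F X k)).map_sum
      (fun i (j : Fin k) => slot F j (P i))
    simp only [MultilinearMap.mkPiAlgebraFin_apply] at h1
    rw [map_list_prod, List.map_ofFn]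
    have h2 : (coproduct F X k ∘ P) = fun i => ∑ j, slot F j (P i) := by
      funext i; exact hP i k
    rw [h2, h1]
    refine Finset.sum_congr rfl fun f _ => ?_
    rw [← prod_slot_eq_pureTensor, List.ofFn_eq_map]
  rw [convolution, LinearMap.comp_apply, AlgHom.toLinearMap_apply, h, map_sum]
  simp only [mulMap_pureTensor]

theorem convolution_word (g : Fin k → WordAlg F X →ₗ[F] WordAlg F X) {m : ℕ} (h : Fin m → X) :
    convolution g (word F (List.ofFn h)) = ∑ f : Fin m → Fin k,
      (List.ofFn fun j => g j (word F (((List.finRange m).filter (f · = j)).map h))).prod := by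
  have := convolution_prod g (fun i => word F [h i]) (fun i => isPrimitive_letter _)
  rw [word_eq_prod, List.map_ofFn]
  refine this.trans (Finset.sum_congr rfl fun f _ => ?_)
  congr 2
  funext j
  rw [word_eq_prod (List.map _ _), List.map_map]
  rfl

end Convolution

/-! ### Homogeneous components -/

section Homogeneous

variable {F : Type*} [CommRing F] {X : Type*}

variable (F X) in
/-- The homogeneous component of degree `d` of the free associative algebra. -/
def homog (d : ℕ) : Submodule F (WordAlg F X) :=
  Submodule.span F {x | ∃ w : List X, w.length = d ∧ word F w = x}

theorem word_mem_homog (w : List X) : word F w ∈ homog F X w.length :=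
  Submodule.subset_span ⟨w, rfl, rfl⟩

theorem mul_mem_homog {d e : ℕ} {x y : WordAlg F X} (hx : x ∈ homog F X d)
    (hy : y ∈ homog F X e) : x * y ∈ homog F X (d + e) := by
  have h : homog F X d * homog F X e ≤ homog F X (d + e) := by
    rw [homog, homog, Submodule.span_mul_span, Submodule.span_le]
    rintro _ ⟨_, ⟨u, hu, rfl⟩, _, ⟨v, hv, rfl⟩, rfl⟩
    exact Submodule.subset_span ⟨u ++ v, by simp [hu, hv], word_append u v⟩
  exact h (Submodule.mul_mem_mul hx hy)

/-- The projection onto the homogeneous component of degree `d`. -/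
def degProj (d : ℕ) : WordAlg F X →ₗ[F] WordAlg F X :=
  linearExtend F fun w => if w.toList.length = d then word F w.toList else 0

theorem degProj_word (d : ℕ) (w : List X) :
    degProj d (word F w) = if w.length = d then word F w else 0 := by
  rw [degProj, linearExtend_word]
  rfl

theorem degProj_of_mem {d : ℕ} {x : WordAlg F X} (hx : x ∈ homog F X d) (e : ℕ) :
    degProj e x = if d = e then x else 0 := by
  induction hx using Submodule.span_induction with
  | mem x h =>
    obtain ⟨w, rfl, rfl⟩ := h
    exact degProj_word _ _
  | zero => simp
  | add x y _ _ hx hy => rw [map_add, hx, hy]; split_ifs <;> simp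
  | smul a x _ hx => rw [map_smul, hx]; split_ifs <;> simp

theorem degProj_one {d : ℕ} (hd : 0 < d) : degProj d (1 : WordAlg F X) = 0 := by
  rw [← word_nil, degProj_word]
  simp [hd.ne]

end Homogeneous

/-! ### The Dynkin operator and the right adjoint action -/

section Dynkin

variable {F : Type*} [CommRing F] {X : Type*}

variable (F X) in
/-- The algebra homomorphism sending a letter `x` to `y ↦ [y, x]`, with values in the opposite
algebra of endomorphisms. -/
def adjointHom : WordAlg F X →ₐ[F] (Module.End F (WordAlg F X))ᵐᵒᵖ :=
  MonoidAlgebra.lift F _ (FreeMonoid X) (FreeMonoid.lift fun x =>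
    MulOpposite.op (LinearMap.mulRight F (word F [x]) - LinearMap.mulLeft F (word F [x])))

variable (F X) in
/-- The right adjoint action: a product of letters `x₁ ⋯ xₘ` acts as
`y ↦ [[y, x₁], …, xₘ]`. -/
def rightAd : WordAlg F X →ₗ[F] Module.End F (WordAlg F X) :=
  (MulOpposite.opLinearEquiv F).symm.toLinearMap ∘ₗ (adjointHom F X).toLinearMap

theorem rightAd_eq_unop (a : WordAlg F X) : rightAd F X a = (adjointHom F X a).unop := rfl

theorem rightAd_mul (a b y : WordAlg F X) :
    rightAd F X (a * b) y = rightAd F X b (rightAd F X a y) := by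
  simp [rightAd_eq_unop]

theorem rightAd_one (y : WordAlg F X) : rightAd F X 1 y = y := by
  simp [rightAd_eq_unop]

theorem rightAd_letter (x : X) (y : WordAlg F X) :
    rightAd F X (word F [x]) y = y * word F [x] - word F [x] * y := by
  have h : adjointHom F X (word F [x]) =
      MulOpposite.op (LinearMap.mulRight F (word F [x]) - LinearMap.mulLeft F (word F [x])) := by
    rw [adjointHom, word, MonoidAlgebra.lift_single, one_smul]
    exact FreeMonoid.lift_eval_of _ _
  rw [rightAd_eq_unop, h]
  simp

/-- The Dynkin operator, which sends a word to its left-normed bracketing. -/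
def dynkin : WordAlg F X →ₗ[F] WordAlg F X :=
  linearExtend F fun w => match w.toList with
    | [] => 0
    | x :: v => rightAd F X (word F v) (word F [x])

theorem dynkin_word_cons (x : X) (v : List X) :
    dynkin (word F (x :: v)) = rightAd F X (word F v) (word F [x]) := by
  rw [dynkin, linearExtend_word]
  rfl

theorem dynkin_letter (x : X) : dynkin (word F [x]) = word F [x] := by
  rw [dynkin_word_cons, word_nil, rightAd_one]

/-- Since `d` is positive, the innermost letter of the bracketing belongs to `x`; all of `y` acts
afterwards by brackets. -/
theorem dynkin_mul {d : ℕ} (hd : 0 < d) {x : WordAlg F X} (hx : x ∈ homog F X d)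
    (y : WordAlg F X) : dynkin (x * y) = rightAd F X y (dynkin x) := by
  induction hx using Submodule.span_induction with
  | mem x h =>
    obtain ⟨w, rfl, rfl⟩ := h
    obtain ⟨a, w, rfl⟩ := List.exists_cons_of_length_pos hd
    have h : dynkin ∘ₗ LinearMap.mulLeft F (word F (a :: w)) =
        (rightAd F X).flip (dynkin (word F (a :: w))) := by
      refine wordAlg_ext fun v => ?_
      simp only [LinearMap.comp_apply, LinearMap.mulLeft_apply, LinearMap.flip_apply]
      rw [← word_append, List.cons_append, dynkin_word_cons, dynkin_word_cons, word_append,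
        rightAd_mul]
    exact DFunLike.congr_fun h y
  | zero => simp
  | add x z _ _ hx hz => rw [add_mul, map_add, map_add, hx, hz, map_add]
  | smul a x _ hx => rw [smul_mul_assoc, map_smul, map_smul, hx, map_smul]

end Dynkin

/-! ### Lie elements and the Dynkin-Specht-Wever identity -/

section LieElements

variable {F : Type*} [CommRing F] {X : Type*}

variable (F X) in
/-- The elements of degree `d` that have the characteristic properties of Lie elements. -/
def lieElements (d : ℕ) : Submodule F (WordAlg F X) where
  carrier := {P | P ∈ homog F X d ∧ IsPrimitive P ∧ dynkin P = (d : F) • P ∧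
    ∀ y, rightAd F X P y = y * P - P * y}
  zero_mem' := ⟨zero_mem _, fun k => by simp, by simp, fun y => by simp⟩
  add_mem' := by
    rintro a b ⟨h1, h2, h3, h4⟩ ⟨h1', h2', h3', h4'⟩
    refine ⟨add_mem h1 h1', fun k => ?_, ?_, fun y => ?_⟩
    · simp only [map_add, Finset.sum_add_distrib, h2 k, h2' k]
    · rw [map_add, h3, h3', smul_add]
    · rw [map_add, LinearMap.add_apply, h4, h4', mul_add, add_mul]; abel
  smul_mem' := by
    rintro c a ⟨h1, h2, h3, h4⟩
    refine ⟨Submodule.smul_mem _ _ h1, fun k => ?_, ?_, fun y => ?_⟩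
    · simp only [map_smul, ← Finset.smul_sum, h2 k]
    · rw [map_smul, h3, smul_comm]
    · rw [map_smul, LinearMap.smul_apply, h4, smul_sub, mul_smul_comm, smul_mul_assoc]

theorem lieElements.mem_homog {d : ℕ} {P : WordAlg F X} (h : P ∈ lieElements F X d) :
    P ∈ homog F X d := h.1

theorem lieElements.isPrimitive {d : ℕ} {P : WordAlg F X} (h : P ∈ lieElements F X d) :
    IsPrimitive P := h.2.1

theorem lieElements.dynkin_eq {d : ℕ} {P : WordAlg F X} (h : P ∈ lieElements F X d) :
    dynkin P = (d : F) • P := h.2.2.1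

theorem lieElements.rightAd_eq {d : ℕ} {P : WordAlg F X} (h : P ∈ lieElements F X d)
    (y : WordAlg F X) : rightAd F X P y = y * P - P * y := h.2.2.2 y

theorem letter_mem_lieElements (x : X) : word F [x] ∈ lieElements F X 1 :=
  ⟨word_mem_homog [x], isPrimitive_letter x, by simp [dynkin_letter], rightAd_letter x⟩

/-- The mixed terms cancel because different slots commute. -/
theorem IsPrimitive.commutator {P Q : WordAlg F X} (hP : IsPrimitive P) (hQ : IsPrimitive Q) :
    IsPrimitive (P * Q - Q * P) := by
  intro k
  rw [map_sub, map_mul, map_mul, hP k, hQ k, Finset.sum_mul_sum, Finset.sum_mul_sum]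
  rw [Finset.sum_comm (f := fun i j => slot F i Q * slot F j P), ← Finset.sum_sub_distrib]
  refine Finset.sum_congr rfl fun i _ => ?_
  rw [← Finset.sum_sub_distrib, Finset.sum_eq_single i]
  · simp
  · intro j _ hj
    exact sub_eq_zero.2 (slot_commute hj.symm P Q)
  · simp

/-- By `dynkin_mul`, the Dynkin operator sends `P * Q` to `d` times the commutator and `Q * P` to
`-e` times it, whence the eigenvalue `d + e`. The adjoint property is the Jacobi identity. -/
theorem commutator_mem_lieElements {d e : ℕ} (hd : 0 < d) (he : 0 < e) {P Q : WordAlg F X}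
    (hP : P ∈ lieElements F X d) (hQ : Q ∈ lieElements F X e) :
    P * Q - Q * P ∈ lieElements F X (d + e) := by
  refine ⟨sub_mem (mul_mem_homog hP.1 hQ.1) (add_comm e d ▸ mul_mem_homog hQ.1 hP.1),
    hP.2.1.commutator hQ.2.1, ?_, fun y => ?_⟩
  · rw [map_sub, dynkin_mul hd hP.1, dynkin_mul he hQ.1, lieElements.dynkin_eq hP,
      lieElements.dynkin_eq hQ, map_smul, map_smul, lieElements.rightAd_eq hP,
      lieElements.rightAd_eq hQ, Nat.cast_add, add_smul, ← neg_sub (P * Q),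
      smul_neg, sub_neg_eq_add]
  · rw [map_sub, LinearMap.sub_apply, rightAd_mul, rightAd_mul,
      lieElements.rightAd_eq hP, lieElements.rightAd_eq hQ,
      lieElements.rightAd_eq hP, lieElements.rightAd_eq hQ]
    noncomm_ring

theorem dynkin_word_mem_lieElements {w : List X} (hw : w ≠ []) :
    dynkin (word F w) ∈ lieElements F X w.length := by
  induction w using List.reverseRecOn with
  | nil => exact absurd rfl hw
  | append_singleton w x ih =>
    rcases eq_or_ne w [] with rfl | h
    · simpa [dynkin_letter] using letter_mem_lieElements x
    · have hl : 0 < w.length := List.length_pos_iff.2 h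
      rw [word_append, dynkin_mul hl (word_mem_homog w), rightAd_letter, List.length_append]
      exact commutator_mem_lieElements hl one_pos (ih h) (letter_mem_lieElements x)

/-- The Dynkin operator restricted to the homogeneous component of degree `d`. -/
def dynkinProj (d : ℕ) : WordAlg F X →ₗ[F] WordAlg F X := dynkin ∘ₗ degProj d

theorem dynkinProj_one {d : ℕ} (hd : 0 < d) : dynkinProj d (1 : WordAlg F X) = 0 := by
  rw [dynkinProj, LinearMap.comp_apply, degProj_one hd, map_zero]

theorem dynkinProj_word (d : ℕ) (w : List X) :
    dynkinProj d (word F w) = if w.length = d then dynkin (word F w) else 0 := by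
  rw [dynkinProj, LinearMap.comp_apply, degProj_word]
  split_ifs <;> simp

theorem dynkinProj_word_mem {d : ℕ} (hd : 0 < d) (w : List X) :
    dynkinProj d (word F w) ∈ lieElements F X d := by
  rw [dynkinProj_word]
  split_ifs with h
  · subst h
    exact dynkin_word_mem_lieElements (List.length_pos_iff.1 hd)
  · exact zero_mem _

theorem lieElements.dynkinProj_eq {d : ℕ} {P : WordAlg F X} (h : P ∈ lieElements F X d) (e : ℕ) :
    dynkinProj e P = if d = e then (e : F) • P else 0 := by
  rw [dynkinProj, LinearMap.comp_apply, degProj_of_mem (lieElements.mem_homog h)]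
  split_ifs with hd
  · rw [lieElements.dynkin_eq h, hd]
  · simp

end LieElements

/-! ### Convolutions of Dynkin operators on products of Lie elements -/

section LieProducts

variable {F : Type*} [CommRing F] {X : Type*} {k m : ℕ}

theorem prod_ofFn_smul {A : Type*} [Ring A] [Algebra F A] (c : Fin k → F) (x : Fin k → A) :
    (List.ofFn fun j => c j • x j).prod = (∏ j, c j) • (List.ofFn x).prod := by
  simpa using (MultilinearMap.mkPiAlgebraFin F k A).map_smul_univ c x

theorem prod_ofFn_eq_zero {A : Type*} [Ring A] [Algebra F A] {x : Fin k → A} {j : Fin k}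
    (h : x j = 0) : (List.ofFn x).prod = 0 := by
  simpa using (MultilinearMap.mkPiAlgebraFin F k A).map_coord_zero j h

theorem filter_finRange_eq_nil {f : Fin m → Fin k} {j : Fin k} (h : ∀ i, f i ≠ j) :
    (List.finRange m).filter (f · = j) = [] := by
  simpa [List.filter_eq_nil_iff] using h

theorem filter_finRange_perm (π : Equiv.Perm (Fin k)) (j : Fin k) :
    (List.finRange k).filter (π.symm · = j) = [π j] := by
  rw [← List.perm_singleton,
    List.perm_ext_iff_of_nodup ((List.nodup_finRange k).filter _) (List.nodup_singleton _)]
  intro a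
  simp [Equiv.symm_apply_eq]

/-- Distributing the factors over slots and multiplying the slots together amounts to a
rearrangement of the factors. -/
theorem flatten_filter_perm {α : Type*} {l : List α} (hl : l.Nodup) (f : α → Fin k) :
    (List.ofFn fun j => l.filter (f · = j)).flatten.Perm l := by
  rw [List.perm_ext_iff_of_nodup _ hl]
  · intro a; simp [List.mem_ofFn']
  · rw [List.nodup_flatten]
    refine ⟨?_, ?_⟩
    · intro l' h
      obtain ⟨j, rfl⟩ := (List.mem_ofFn' _ _).1 h
      exact hl.filter _
    · rw [List.pairwise_ofFn]
      intro i j hij a ha hb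
      simp only [List.mem_filter, decide_eq_true_eq] at ha hb
      exact hij.ne (ha.2.symm.trans hb.2)

/-- The convolution of the homogeneous projections to degrees `q 0, q 1, …`. -/
def degConv (q : Fin k → ℕ) : WordAlg F X →ₗ[F] WordAlg F X :=
  convolution fun j => degProj (q j)

/-- The convolution of the Dynkin operators of degrees `d 0, d 1, …`. -/
def dynkinConv (d : Fin k → ℕ) : WordAlg F X →ₗ[F] WordAlg F X :=
  convolution fun j => dynkinProj (d j)

/-- Pigeonhole: some slot stays empty and contains `1`, which a Dynkin operator of positive degree
kills. -/
theorem dynkinConv_prod_of_lt (d : Fin k → ℕ) (hd : ∀ j, 0 < d j) (hmk : m < k)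
    (P : Fin m → WordAlg F X) (hP : ∀ i, IsPrimitive (P i)) :
    dynkinConv d (List.ofFn P).prod = 0 := by
  rw [dynkinConv, convolution_prod _ P hP]
  refine Finset.sum_eq_zero fun f _ => ?_
  have hf : ¬ Function.Surjective f := fun h => by
    have := Fintype.card_le_of_surjective f h
    simp at this
    omega
  simp only [Function.Surjective, not_forall, not_exists] at hf
  obtain ⟨j, hj⟩ := hf
  refine prod_ofFn_eq_zero (F := F) (j := j) ?_
  rw [filter_finRange_eq_nil hj, List.map_nil, List.prod_nil, dynkinProj_one (hd j)]

/-- A convolution of Dynkin operators, applied to a product of as many Lie elements, rearranges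
these elements in all ways that match the degrees. -/
theorem dynkinConv_prod (d e : Fin k → ℕ) (hd : ∀ j, 0 < d j)
    (P : Fin k → WordAlg F X) (hP : ∀ i, P i ∈ lieElements F X (e i)) :
    dynkinConv d (List.ofFn P).prod = ∑ π : Equiv.Perm (Fin k),
      if ∀ j, e (π j) = d j then (∏ j, (d j : F)) • (List.ofFn fun j => P (π j)).prod else 0 := by
  rw [dynkinConv, convolution_prod _ P fun i => lieElements.isPrimitive (hP i)]
  symm
  refine Finset.sum_of_injOn (fun π => (π.symm : Fin k → Fin k)) ?_ (by simp) ?_ ?_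
  · intro π _ ρ _ h
    exact Equiv.symm_bijective.injective (DFunLike.coe_injective h)
  · intro f _ hf
    -- A surjective self-map of `Fin k` is the inverse of a permutation, so it would lie in the
    -- image of the reindexing; any other map leaves a slot empty.
    have hs : ¬ Function.Surjective f := fun h => hf (by
      have hb : Function.Bijective f := ⟨Finite.injective_iff_surjective.2 h, h⟩
      exact ⟨(Equiv.ofBijective f hb).symm, by simp, by ext; simp⟩)
    simp only [Function.Surjective, not_forall, not_exists] at hs
    obtain ⟨j, hj⟩ := hs
    refine prod_ofFn_eq_zero (F := F) (j := j) ?_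
    rw [filter_finRange_eq_nil hj, List.map_nil, List.prod_nil, dynkinProj_one (hd j)]
  · intro π _
    simp only [filter_finRange_perm, List.map_cons, List.map_nil, List.prod_singleton]
    split_ifs with h
    · rw [← prod_ofFn_smul]
      congr 2
      funext j
      rw [lieElements.dynkinProj_eq (hP (π j)), if_pos (h j)]
    · push Not at h
      obtain ⟨j, hj⟩ := h
      refine (prod_ofFn_eq_zero (F := F) (j := j) ?_).symm
      rw [lieElements.dynkinProj_eq (hP (π j)), if_neg hj]

variable (F X) in
/-- The span of the products of Lie elements of degrees `d 0, d 1, …`. -/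
def lieProducts (d : Fin k → ℕ) : Submodule F (WordAlg F X) :=
  Submodule.span F {x | ∃ P : Fin k → WordAlg F X, (∀ i, P i ∈ lieElements F X (d i)) ∧
    (List.ofFn P).prod = x}

theorem dynkinConv_word_mem_lieProducts (d : Fin k → ℕ) (hd : ∀ j, 0 < d j) (w : List X) :
    dynkinConv d (word F w) ∈ lieProducts F X d := by
  obtain ⟨m, h, rfl⟩ : ∃ (m : ℕ) (h : Fin m → X), w = List.ofFn h := ⟨_, w.get, by simp⟩
  rw [dynkinConv, convolution_word]
  refine Submodule.sum_mem _ fun f _ => Submodule.subset_span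
    ⟨_, fun i => ?_, rfl⟩
  exact dynkinProj_word_mem (hd i) _

theorem dynkinConv_mem_lieProducts (d : Fin k → ℕ) (hd : ∀ j, 0 < d j) (x : WordAlg F X) :
    dynkinConv d x ∈ lieProducts F X d := by
  have h : Submodule.span F (Set.range (word F : List X → WordAlg F X)) ≤
      (lieProducts F X d).comap (dynkinConv d) := by
    rw [Submodule.span_le]
    rintro _ ⟨w, rfl⟩
    exact dynkinConv_word_mem_lieProducts d hd w
  rw [span_range_word] at h
  exact h (Submodule.mem_top (x := x))

/-- The number of permutations of the places that preserve `d`. -/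
def stabCard (d : Fin k → ℕ) : ℕ :=
  (Finset.univ.filter fun π : Equiv.Perm (Fin k) => ∀ j, d (π j) = d j).card

theorem stabCard_pos (d : Fin k → ℕ) : 0 < stabCard d :=
  Finset.card_pos.2 ⟨1, by simp⟩

variable (F) in
/-- The scalar by which a convolution of Dynkin operators is quasi-idempotent. -/
def dynkinScalar (d : Fin k → ℕ) : F := (stabCard d : F) * ∏ j, (d j : F)

theorem dynkinScalar_ne_zero {F : Type*} [Field F] [CharZero F] {d : Fin k → ℕ}
    (hd : ∀ j, 0 < d j) : dynkinScalar F d ≠ 0 :=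
  mul_ne_zero (Nat.cast_ne_zero.2 (stabCard_pos d).ne')
    (Finset.prod_ne_zero_iff.2 fun j _ => Nat.cast_ne_zero.2 (hd j).ne')

/-- The image of a word is a sum, over all distributions of its letters, of products of Lie elements
of degrees `d`. Each degree-preserving rearrangement only permutes the terms of this sum, so it
contributes the same multiple. -/
theorem dynkinConv_dynkinConv (d : Fin k → ℕ) (hd : ∀ j, 0 < d j) (x : WordAlg F X) :
    dynkinConv d (dynkinConv d x) = dynkinScalar F d • dynkinConv d x := by
  have key : dynkinConv d ∘ₗ dynkinConv d = dynkinScalar F d • dynkinConv (F := F) (X := X) d := by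
    refine wordAlg_ext fun w => ?_
    obtain ⟨m, h, rfl⟩ : ∃ (m : ℕ) (h : Fin m → X), w = List.ofFn h := ⟨_, w.get, by simp⟩
    rw [LinearMap.comp_apply, LinearMap.smul_apply]
    have hw := convolution_word (fun j => dynkinProj (F := F) (d j)) h
    rw [← dynkinConv] at hw
    conv_lhs => rw [hw, map_sum]
    have h1 : ∀ f : Fin m → Fin k, dynkinConv d (List.ofFn fun j => dynkinProj (d j)
        (word F (((List.finRange m).filter (f · = j)).map h))).prod = _ := fun f =>
      dynkinConv_prod d d hd _ fun i => dynkinProj_word_mem (hd i) _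
    simp only [h1]
    rw [Finset.sum_comm]
    have h2 : ∀ π : Equiv.Perm (Fin k), (∑ f : Fin m → Fin k, if ∀ j, d (π j) = d j then
        (∏ j, (d j : F)) • (List.ofFn fun j => dynkinProj (d (π j))
          (word F (((List.finRange m).filter (f · = π j)).map h))).prod else 0) =
        if ∀ j, d (π j) = d j then
          (∏ j, (d j : F)) • dynkinConv d (word F (List.ofFn h)) else 0 := by
      intro π
      split_ifs with hπ
      · rw [← Finset.smul_sum, hw]
        congr 1
        -- Permuting the slots by `π` is undone by replacing the distribution `f` with `π.symm ∘ f`.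
        refine Fintype.sum_equiv (Equiv.arrowCongr (Equiv.refl _) π.symm) _ _ fun f => ?_
        congr 2
        funext j
        rw [hπ j]
        congr 4
        funext i
        simp [Equiv.symm_apply_eq]
      · simp
    simp only [h2]
    rw [← Finset.sum_filter, Finset.sum_const, ← Nat.cast_smul_eq_nsmul F, smul_smul]
    rfl
  exact DFunLike.congr_fun key x

end LieProducts

/-! ### The filtration by the number of Lie factors -/

section Filtration

variable {F : Type*} [CommRing F] {X : Type*} {k m n : ℕ}

/-- A list of homogeneous Lie elements of positive degrees, with these degrees. -/
def IsLieList (l : List (ℕ × WordAlg F X)) : Prop :=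
  ∀ p ∈ l, 0 < p.1 ∧ p.2 ∈ lieElements F X p.1

variable (F X) in
/-- The span of the products of fewer than `m` Lie elements of total degree `n`. -/
def lowProducts (m n : ℕ) : Submodule F (WordAlg F X) :=
  Submodule.span F {x | ∃ l : List (ℕ × WordAlg F X), IsLieList l ∧ l.length < m ∧
    (l.map Prod.fst).sum = n ∧ (l.map Prod.snd).prod = x}

theorem mul_mem_lowProducts {d : ℕ} (hd : 0 < d) {P : WordAlg F X} (hP : P ∈ lieElements F X d)
    {x : WordAlg F X} (hx : x ∈ lowProducts F X m n) :
    P * x ∈ lowProducts F X (m + 1) (d + n) := by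
  have h : lowProducts F X m n ≤
      (lowProducts F X (m + 1) (d + n)).comap (LinearMap.mulLeft F P) := by
    rw [lowProducts, Submodule.span_le]
    rintro _ ⟨l, hl, hlm, hln, rfl⟩
    refine Submodule.subset_span ⟨(d, P) :: l, ?_, by simpa, by simpa, by simp⟩
    rintro p hp
    rcases List.mem_cons.1 hp with rfl | hp
    · exact ⟨hd, hP⟩
    · exact hl p hp
  exact h hx

/-- A product of Lie elements may be rearranged modulo products of fewer Lie elements. -/
theorem prod_sub_prod_mem_lowProducts {l₁ l₂ : List (ℕ × WordAlg F X)} (h : l₁.Perm l₂)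
    (hl : IsLieList l₁) :
    (l₁.map Prod.snd).prod - (l₂.map Prod.snd).prod ∈
      lowProducts F X l₁.length (l₁.map Prod.fst).sum := by
  induction h with
  | nil => simp
  | cons p _ ih =>
    simp only [List.map_cons, List.prod_cons, List.sum_cons, List.length_cons, ← mul_sub]
    have hp := hl p List.mem_cons_self
    exact mul_mem_lowProducts hp.1 hp.2 (ih fun q hq => hl q (List.mem_cons_of_mem _ hq))
  | swap p r l =>
    have hr := hl r (by simp)
    have hp := hl p (by simp)
    -- The difference of the two orders is the product in which the two factors are merged into
    -- their commutator.
    refine Submodule.subset_span ⟨(r.1 + p.1, r.2 * p.2 - p.2 * r.2) :: l, ?_, by simp,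
      by simp [add_assoc], by simp [sub_mul, mul_assoc]⟩
    rintro q hq
    rcases List.mem_cons.1 hq with rfl | hq
    · exact ⟨by simp [hr.1], commutator_mem_lieElements hr.1 hp.1 hr.2 hp.2⟩
    · exact hl q (by simp [hq])
  | trans h₁ _ ih₁ ih₂ =>
    have h2 := ih₂ fun p hp => hl p (h₁.mem_iff.2 hp)
    rw [← h₁.length_eq, ← (h₁.map Prod.fst).sum_eq] at h2
    simpa using add_mem (ih₁ hl) h2

/-- A convolution of Dynkin operators kills the products of as many or fewer Lie elements whose
degrees do not match. -/
theorem dynkinConv_prod_eq_zero (d : Fin k → ℕ) (hd : ∀ j, 0 < d j) (e : Fin m → ℕ)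
    (hmk : m ≤ k) (hde : ¬ (List.ofFn e).Perm (List.ofFn d)) (P : Fin m → WordAlg F X)
    (hP : ∀ i, P i ∈ lieElements F X (e i)) : dynkinConv d (List.ofFn P).prod = 0 := by
  rcases hmk.lt_or_eq with h | rfl
  · exact dynkinConv_prod_of_lt d hd h P fun i => lieElements.isPrimitive (hP i)
  · rw [dynkinConv_prod d e hd P hP]
    refine Finset.sum_eq_zero fun π _ => if_neg fun h => hde ?_
    rw [← funext h]
    exact (Equiv.Perm.ofFn_comp_perm π e).symm

theorem dynkinConv_eq_zero_of_mem_lieProducts (d : Fin k → ℕ) (hd : ∀ j, 0 < d j) (e : Fin m → ℕ)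
    (hmk : m ≤ k) (hde : ¬ (List.ofFn e).Perm (List.ofFn d)) {x : WordAlg F X}
    (hx : x ∈ lieProducts F X e) : dynkinConv d x = 0 := by
  have h : lieProducts F X e ≤ LinearMap.ker (dynkinConv (F := F) (X := X) d) := by
    rw [lieProducts, Submodule.span_le]
    rintro _ ⟨P, hP, rfl⟩
    exact dynkinConv_prod_eq_zero d hd e hmk hde P hP
  exact h hx

theorem dynkinConv_eq_zero_of_mem_lowProducts (d : Fin k → ℕ) (hd : ∀ j, 0 < d j)
    (hmk : m ≤ k) {x : WordAlg F X} (hx : x ∈ lowProducts F X m n) : dynkinConv d x = 0 := by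
  have h : lowProducts F X m n ≤ LinearMap.ker (dynkinConv (F := F) (X := X) d) := by
    rw [lowProducts, Submodule.span_le]
    rintro _ ⟨l, hl, hlm, -, rfl⟩
    have : l.map Prod.snd = List.ofFn fun i => (l.get i).2 := by
      rw [show (fun i => (l.get i).2) = Prod.snd ∘ l.get from rfl, ← List.map_ofFn]; simp
    rw [SetLike.mem_coe, LinearMap.mem_ker, this]
    exact dynkinConv_prod_of_lt d hd (hlm.trans_le hmk) _ fun i =>
      lieElements.isPrimitive (hl _ (l.get_mem i)).2
  exact h hx

theorem isLieList_ofFn {d : Fin m → ℕ} (hd : ∀ j, 0 < d j) {P : Fin m → WordAlg F X}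
    (hP : ∀ i, P i ∈ lieElements F X (d i)) : IsLieList (List.ofFn fun i => (d i, P i)) := by
  intro p hp
  obtain ⟨i, rfl⟩ := (List.mem_ofFn' _ _).1 hp
  exact ⟨hd i, hP i⟩

/-- `prod_sub_prod_mem_lowProducts` for the rearrangement of a family along a list of indices. -/
theorem prod_sub_prod_map_mem_lowProducts {d : Fin m → ℕ} (hd : ∀ j, 0 < d j)
    {P : Fin m → WordAlg F X} (hP : ∀ i, P i ∈ lieElements F X (d i)) {l : List (Fin m)}
    (hl : l.Perm (List.finRange m)) :
    (l.map P).prod - (List.ofFn P).prod ∈ lowProducts F X m (∑ i, d i) := by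
  have h := prod_sub_prod_mem_lowProducts (hl.symm.map fun i => (d i, P i))
    (by rw [← List.ofFn_eq_map]; exact isLieList_ofFn hd hP)
  simp only [List.map_map, List.length_map, List.length_finRange] at h
  rw [← neg_sub]
  refine neg_mem ?_
  have h1 : (List.map (Prod.fst ∘ fun i => (d i, P i)) (List.finRange m)).sum = ∑ i, d i := by
    rw [← List.ofFn_eq_map, List.sum_ofFn]; rfl
  have h2 : (Prod.snd ∘ fun i => (d i, P i)) = P := rfl
  rwa [h1, h2, ← List.ofFn_eq_map] at h

/-- In the sum of `dynkinConv_prod` every rearranged product may be replaced by the original one,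
and `stabCard d` permutations contribute. -/
theorem dynkinConv_prod_sub_mem_lowProducts {d : Fin k → ℕ} (hd : ∀ j, 0 < d j)
    {P : Fin k → WordAlg F X} (hP : ∀ i, P i ∈ lieElements F X (d i)) :
    dynkinConv d (List.ofFn P).prod - dynkinScalar F d • (List.ofFn P).prod ∈
      lowProducts F X k (∑ i, d i) := by
  have h : dynkinScalar F d • (List.ofFn P).prod = ∑ π : Equiv.Perm (Fin k),
      if ∀ j, d (π j) = d j then (∏ j, (d j : F)) • (List.ofFn P).prod else 0 := by
    rw [← Finset.sum_filter, Finset.sum_const, ← Nat.cast_smul_eq_nsmul F, smul_smul]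
    rfl
  rw [dynkinConv_prod d d hd P hP, h, ← Finset.sum_sub_distrib]
  refine Submodule.sum_mem _ fun π _ => ?_
  split_ifs with hπ
  · rw [← smul_sub]
    refine Submodule.smul_mem _ _ ?_
    have := prod_sub_prod_map_mem_lowProducts hd hP (l := (List.finRange k).map π)
      (Equiv.Perm.map_finRange_perm π)
    rwa [List.map_map, ← List.ofFn_eq_map] at this
  · simp

end Filtration

/-! ### Convolutions of degree projections on products of Lie elements -/

section DegreeConvolution

variable {F : Type*} [CommRing F] {X : Type*} {k m n : ℕ}

/-- The ways to distribute parts `d 0, d 1, …` to `k` places with sums `q 0, q 1, …`. -/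
def distributions (d : Fin m → ℕ) (q : Fin k → ℕ) : Finset (Fin m → Fin k) :=
  Finset.univ.filter fun f =>
    ∀ j, (((List.finRange m).filter (f · = j)).map d).sum = q j

theorem prod_map_mem_homog {d : Fin m → ℕ} {P : Fin m → WordAlg F X}
    (hP : ∀ i, P i ∈ homog F X (d i)) (l : List (Fin m)) :
    (l.map P).prod ∈ homog F X (l.map d).sum := by
  induction l with
  | nil => exact word_mem_homog (F := F) ([] : List X)
  | cons a l ih => simpa using mul_mem_homog (hP a) ih

/-- A distribution of the factors survives the projections exactly when the degrees in each slot add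
up to the prescribed part of `q`. -/
theorem degConv_prod (q : Fin k → ℕ) {d : Fin m → ℕ} {P : Fin m → WordAlg F X}
    (hP : ∀ i, P i ∈ lieElements F X (d i)) :
    degConv q (List.ofFn P).prod = ∑ f ∈ distributions d q,
      ((List.ofFn fun j => (List.finRange m).filter (f · = j)).flatten.map P).prod := by
  rw [degConv, convolution_prod _ P fun i => lieElements.isPrimitive (hP i), distributions,
    Finset.sum_filter]
  refine Finset.sum_congr rfl fun f _ => ?_
  have h : ∀ j, degProj (q j) (((List.finRange m).filter (f · = j)).map P).prod = _ := fun j =>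
    degProj_of_mem (prod_map_mem_homog (fun i => lieElements.mem_homog (hP i)) _) (q j)
  simp only [h]
  split_ifs with hf
  · rw [List.map_flatten, List.prod_flatten, List.map_map, List.map_ofFn]
    congr 2
    funext j
    exact if_pos (hf j)
  · push Not at hf
    obtain ⟨j, hj⟩ := hf
    exact prod_ofFn_eq_zero (F := F) (j := j) (if_neg hj)

theorem degConv_eq_zero_of_mem_lieProducts {q : Fin k → ℕ} {d : Fin m → ℕ}
    (h : distributions d q = ∅) {x : WordAlg F X} (hx : x ∈ lieProducts F X d) :
    degConv q x = 0 := by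
  have h : lieProducts F X d ≤ LinearMap.ker (degConv (F := F) (X := X) q) := by
    rw [lieProducts, Submodule.span_le]
    rintro _ ⟨P, hP, rfl⟩
    rw [SetLike.mem_coe, LinearMap.mem_ker, degConv_prod q hP, h, Finset.sum_empty]
  exact h hx

theorem degConv_sub_mem_lowProducts (q : Fin k → ℕ) {d : Fin m → ℕ} (hd : ∀ i, 0 < d i)
    {x : WordAlg F X} (hx : x ∈ lieProducts F X d) :
    degConv q x - ((distributions d q).card : F) • x ∈ lowProducts F X m (∑ i, d i) := by
  have h : lieProducts F X d ≤ (lowProducts F X m (∑ i, d i)).comap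
      (degConv (F := F) (X := X) q - ((distributions d q).card : F) • LinearMap.id) := by
    rw [lieProducts, Submodule.span_le]
    rintro _ ⟨P, hP, rfl⟩
    rw [SetLike.mem_coe, Submodule.mem_comap, LinearMap.sub_apply, LinearMap.smul_apply,
      LinearMap.id_apply, degConv_prod q hP, Nat.cast_smul_eq_nsmul, ← Finset.sum_const,
      ← Finset.sum_sub_distrib]
    exact Submodule.sum_mem _ fun f _ => prod_sub_prod_map_mem_lowProducts hd hP
      (flatten_filter_perm (List.nodup_finRange m) f)
  exact h hx

/-- The inner image lies in the span of products of `m` Lie elements of degrees `e`. There `degConv`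
is a scalar up to fewer than `m ≤ k` factors, and the outer operator kills both contributions. -/
theorem dynkinConv_degConv_dynkinConv_of_ne (q : Fin n → ℕ) {d : Fin k → ℕ} {e : Fin m → ℕ}
    (hd : ∀ i, 0 < d i) (he : ∀ i, 0 < e i) (hmk : m ≤ k)
    (hde : ¬ (List.ofFn e).Perm (List.ofFn d)) (x : WordAlg F X) :
    dynkinConv d (degConv q (dynkinConv e x)) = 0 := by
  have hx := dynkinConv_mem_lieProducts e he x
  have h := dynkinConv_eq_zero_of_mem_lowProducts d hd hmk (degConv_sub_mem_lowProducts q he hx)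
  rwa [map_sub, map_smul, dynkinConv_eq_zero_of_mem_lieProducts d hd e hmk hde hx, smul_zero,
    sub_zero] at h

theorem dynkinConv_degConv_dynkinConv_self (q : Fin n → ℕ) {d : Fin k → ℕ}
    (hd : ∀ i, 0 < d i) (x : WordAlg F X) :
    dynkinConv d (degConv q (dynkinConv d x)) =
      (((distributions d q).card : F) * dynkinScalar F d) • dynkinConv d x := by
  have hx := dynkinConv_mem_lieProducts d hd x
  have h := dynkinConv_eq_zero_of_mem_lowProducts d hd le_rfl (degConv_sub_mem_lowProducts q hd hx)
  rwa [map_sub, map_smul, dynkinConv_dynkinConv d hd, smul_smul, sub_eq_zero] at h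

end DegreeConvolution

/-! ### Words are spanned by the images for partitions -/

section Spanning

variable {F : Type*} [Field F] [CharZero F] {X : Type*}

/-- The span of the images of the convolutions of Dynkin operators for all partitions of `n`. -/
def dynkinSpan (F X : Type*) [CommRing F] (n : ℕ) : Submodule F (WordAlg F X) :=
  ⨆ (r : Composition n) (_ : IsPartition r),
    LinearMap.range (dynkinConv (F := F) (X := X) r.blocksFun)

/-- Induction on the number of factors: modulo shorter products, the factors may be sorted by
degree, and the sorted product is a nonzero multiple of its image under `dynkinConv`. Characteristic
zero permits the division. -/
theorem prod_mem_dynkinSpan {n : ℕ} (m : ℕ) : ∀ l : List (ℕ × WordAlg F X), IsLieList l →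
    l.length < m → (l.map Prod.fst).sum = n → (l.map Prod.snd).prod ∈ dynkinSpan F X n := by
  induction m with
  | zero => intro l _ h; omega
  | succ m ih =>
    intro l hl hlm hln
    have hlow : ∀ m' ≤ m, lowProducts F X m' n ≤ dynkinSpan F X n := by
      intro m' hm'
      rw [lowProducts, Submodule.span_le]
      rintro _ ⟨l', hl', hlm', hln', rfl⟩
      exact ih l' hl' (by omega) hln'
    -- Weakly decreasing degrees make the degree sequence a partition.
    set s := l.mergeSort fun a b => decide (b.1 ≤ a.1) with hs
    have hperm : s.Perm l := List.mergeSort_perm _ _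
    have hsort : s.Pairwise fun a b => b.1 ≤ a.1 := by
      have := List.pairwise_mergeSort (le := fun a b : ℕ × WordAlg F X => decide (b.1 ≤ a.1))
        (by intro a b c; simp; omega) (by intro a b; simp; omega) l
      simpa using this
    have hsl : IsLieList s := fun p hp => hl p (hperm.mem_iff.1 hp)
    have hsn : (s.map Prod.fst).sum = n := by rw [← hln]; exact (hperm.map _).sum_eq
    have h1 := prod_sub_prod_mem_lowProducts hperm.symm hl
    rw [hln] at h1
    let r : Composition n := ⟨s.map Prod.fst, fun {i} hi => by
      obtain ⟨p, hp, rfl⟩ := List.mem_map.1 hi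
      exact (hsl p hp).1, hsn⟩
    have hr : IsPartition r := by
      show (s.map Prod.fst).Pairwise _
      rw [List.pairwise_map]
      exact hsort
    have hlen : r.length = s.length := by simp [Composition.length, r]
    have h2 := dynkinConv_prod_sub_mem_lowProducts (F := F) (d := r.blocksFun)
      (P := fun i => (s.get (i.cast hlen)).2) (fun j => r.one_le_blocksFun j) (fun i => by
        have := (hsl _ (s.get_mem (i.cast hlen))).2
        simpa [Composition.blocksFun, r] using this)
    have h3 : (List.ofFn fun i => (s.get (i.cast hlen)).2) = s.map Prod.snd := by
      apply List.ext_getElem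
      · simp [hlen]
      · intro i _ _; simp
    rw [h3, r.sum_blocksFun] at h2
    have h4 : dynkinConv r.blocksFun (s.map Prod.snd).prod ∈ dynkinSpan F X n :=
      Submodule.mem_iSup_of_mem r (Submodule.mem_iSup_of_mem hr ⟨_, rfl⟩)
    have h5 := hlow _ (by rw [hlen, hperm.length_eq]; omega) h2
    have h6 := hlow _ (by omega) h1
    have h7 : dynkinScalar F r.blocksFun • (s.map Prod.snd).prod ∈ dynkinSpan F X n := by
      simpa using sub_mem h4 h5
    rw [Submodule.smul_mem_iff _ (dynkinScalar_ne_zero fun j => r.one_le_blocksFun j)] at h7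
    simpa using add_mem h6 h7

theorem word_mem_dynkinSpan (w : List X) : word F w ∈ dynkinSpan F X w.length := by
  rw [word_eq_prod]
  have := prod_mem_dynkinSpan (F := F) (n := w.length) (w.length + 1)
    (w.map fun x => (1, word F [x])) (by
      intro p hp
      obtain ⟨x, _, rfl⟩ := List.mem_map.1 hp
      exact ⟨one_pos, letter_mem_lieElements x⟩) (by simp) (by simp [Function.comp_def])
  rw [List.map_map] at this
  exact this

end Spanning

/-! ### Permutations as words: the action on places -/

section PlaceAction

variable {F : Type*} [CommRing F] {X : Type*} {n : ℕ}

/-- The linear map from the group algebra to the free associative algebra that sends a permutation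
to the word obtained from `g` by permuting the places. -/
def wordMap (g : Fin n → X) : SymAlg F n →ₗ[F] WordAlg F X :=
  linearExtend F fun σ => word F (List.ofFn (g ∘ σ))

@[simp]
theorem wordMap_single (g : Fin n → X) (σ : Equiv.Perm (Fin n)) :
    wordMap g (MonoidAlgebra.single σ 1 : SymAlg F n) = word F (List.ofFn (g ∘ σ)) :=
  linearExtend_single _ _

theorem wordMap_one (g : Fin n → X) : wordMap g (1 : SymAlg F n) = word F (List.ofFn g) :=
  wordMap_single g 1

/-- Left multiplication is absorbed into the word `g`; thus a right multiplication is known once its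
effect at the unit is known for all `g`. -/
theorem wordMap_single_mul (g : Fin n → X) (σ : Equiv.Perm (Fin n)) (a : SymAlg F n) :
    wordMap g (MonoidAlgebra.single σ 1 * a) = wordMap (g ∘ σ) a := by
  have h : wordMap g ∘ₗ LinearMap.mulLeft F (MonoidAlgebra.single σ 1 : SymAlg F n) =
      wordMap (g ∘ σ) := by
    refine linearMap_ext_single fun τ => ?_
    simp [MonoidAlgebra.single_mul_single, Function.comp_assoc]
  exact DFunLike.congr_fun h a

/-- Right multiplication by `x` is transported to `T` as soon as this holds for the unit. -/
theorem wordMap_mul_eq {x : SymAlg F n} {T : WordAlg F X →ₗ[F] WordAlg F X}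
    (h : ∀ g : Fin n → X, wordMap g x = T (word F (List.ofFn g))) (g : Fin n → X)
    (a : SymAlg F n) : wordMap g (a * x) = T (wordMap g a) := by
  have h' : wordMap g ∘ₗ LinearMap.mulRight F x = T ∘ₗ wordMap g := by
    refine linearMap_ext_single fun τ => ?_
    simp [wordMap_single_mul, h]
  exact DFunLike.congr_fun h' a

open Classical in
variable (F n) in
/-- The linear projection to the group algebra which sends the words that are not permutations
to zero. -/
def permProj : WordAlg F (Fin n) →ₗ[F] SymAlg F n :=
  linearExtend F fun w => if h : ∃ σ : Equiv.Perm (Fin n), List.ofFn σ = w.toList then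
    MonoidAlgebra.single h.choose 1 else 0

theorem permProj_word_perm (σ : Equiv.Perm (Fin n)) :
    permProj F n (word F (List.ofFn σ)) = MonoidAlgebra.single σ 1 := by
  have hσ : ∃ τ : Equiv.Perm (Fin n), List.ofFn τ = List.ofFn σ := ⟨σ, rfl⟩
  rw [permProj, linearExtend_word]
  refine (dif_pos hσ).trans ?_
  congr 1
  exact DFunLike.coe_injective (List.ofFn_injective hσ.choose_spec)

theorem permProj_word_of_not_bijective {f : Fin n → Fin n} (hf : ¬ Function.Bijective f) :
    permProj F n (word F (List.ofFn f)) = 0 := by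
  rw [permProj, linearExtend_word]
  refine dif_neg ?_
  rintro ⟨σ, hσ⟩
  exact hf (List.ofFn_injective hσ ▸ σ.bijective)

theorem permProj_wordMap (a : SymAlg F n) : permProj F n (wordMap id a) = a := by
  have h : permProj F n ∘ₗ wordMap id = LinearMap.id :=
    linearMap_ext_single fun σ => by simp [permProj_word_perm]
  exact DFunLike.congr_fun h a

theorem permProj_wordMap_perm (σ : Equiv.Perm (Fin n)) (a : SymAlg F n) :
    permProj F n (wordMap σ a) = MonoidAlgebra.single σ 1 * a := by
  rw [← Function.id_comp (σ : Fin n → Fin n), ← wordMap_single_mul, permProj_wordMap]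

theorem permProj_wordMap_of_not_bijective {f : Fin n → Fin n} (hf : ¬ Function.Bijective f)
    (a : SymAlg F n) : permProj F n (wordMap f a) = 0 := by
  have h : permProj F n ∘ₗ wordMap f = 0 := by
    refine linearMap_ext_single fun σ => ?_
    rw [LinearMap.comp_apply, wordMap_single, LinearMap.zero_apply]
    exact permProj_word_of_not_bijective fun h => hf ((σ.bijective.of_comp_iff f).1 h)
  exact DFunLike.congr_fun h a

theorem wordMap_injective : Function.Injective
    (wordMap (id : Fin n → Fin n) : SymAlg F n → WordAlg F (Fin n)) :=
  Function.LeftInverse.injective permProj_wordMap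

end PlaceAction

/-! ### The element `omega` acts as the Dynkin operator -/

section DynkinElement

variable {F : Type*} [CommRing F] {X : Type*}

theorem ofFn_comp_cycleRange_inv {m : ℕ} (g : Fin m → X) (i : Fin m) :
    List.ofFn (g ∘ ⇑(Fin.cycleRange i)⁻¹) =
      g i :: ((List.ofFn g).take i ++ (List.ofFn g).drop (i + 1)) := by
  obtain _ | m := m
  · exact i.elim0
  rw [List.ofFn_succ]
  congr 1
  · simp [Equiv.Perm.inv_def]
  · rw [← List.eraseIdx_eq_take_drop_succ]
    apply List.ext_getElem
    · rw [List.length_eraseIdx]; simp [Nat.lt_succ_iff.1 i.2]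
    · intro j h1 h2
      have hj : j < m := by simpa using h1
      simp only [List.getElem_ofFn, Function.comp_apply, Equiv.Perm.inv_def,
        Fin.cycleRange_symm_succ, List.getElem_eraseIdx]
      split_ifs with h
      · congr 1
        rw [Fin.succAbove_of_castSucc_lt _ _ (by simpa [Fin.lt_def] using h)]
        rfl
      · congr 1
        rw [Fin.succAbove_of_le_castSucc _ _ (by simpa [Fin.le_def] using h)]
        rfl

/-- The inverse of `Fin.cycleRange i` moves the letter at place `i` to the front, so `1` minus it
brackets the first `i` letters with that letter. Descending induction on `i` brackets the remaining
ones. -/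
theorem wordMap_drop_prod {m : ℕ} : ∀ (r i : ℕ), i + r = m → ∀ g : Fin m → X,
    wordMap g ((((List.finRange m).drop i).map fun i =>
      (1 - MonoidAlgebra.of F (Equiv.Perm (Fin m)) (Fin.cycleRange i)⁻¹ : SymAlg F m)).prod) =
    rightAd F X (word F ((List.ofFn g).drop i)) (word F ((List.ofFn g).take i)) := by
  intro r
  induction r with
  | zero =>
    rintro i hi g
    rw [List.drop_eq_nil_of_le (by simp [← hi]), List.drop_eq_nil_of_le (by simp [← hi]),
      List.take_of_length_le (by simp [← hi])]
    simp [wordMap_one, word_nil, rightAd_one]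
  | succ r ih =>
    rintro i hi g
    have him : i < m := by omega
    have h1 : (List.finRange m).drop i = ⟨i, him⟩ :: (List.finRange m).drop (i + 1) := by
      rw [List.drop_eq_getElem_cons (by simpa using him)]; simp
    have h2 : (List.ofFn g).drop i = g ⟨i, him⟩ :: (List.ofFn g).drop (i + 1) := by
      rw [List.drop_eq_getElem_cons (by simpa using him)]; simp
    have h3 : (List.ofFn g).take (i + 1) = (List.ofFn g).take i ++ [g ⟨i, him⟩] := by
      rw [List.take_succ_eq_append_getElem (by simpa using him)]; simp
    have h4 : ((List.ofFn g).take i).length = i := by simp [him.le]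
    rw [h1, List.map_cons, List.prod_cons, sub_mul, one_mul, map_sub, ih (i + 1) (by omega),
      MonoidAlgebra.of_apply, wordMap_single_mul, ih (i + 1) (by omega),
      ofFn_comp_cycleRange_inv, h2, h3, word_cons (g ⟨i, him⟩), rightAd_mul, rightAd_letter,
      List.drop_succ_cons, List.take_succ_cons, List.drop_left' h4, List.take_left' h4,
      word_append, word_cons (g ⟨i, him⟩) ((List.ofFn g).take i), map_sub]

/-- Degree `0` is a true exception: there `omega` is the empty product `1`, but `dynkin` kills the
empty word. -/
theorem wordMap_omega {m : ℕ} (hm : 0 < m) (g : Fin m → X) :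
    wordMap g (omega F m) = dynkin (word F (List.ofFn g)) := by
  obtain _ | m := m
  · omega
  rw [omega, ← List.drop_one, wordMap_drop_prod m 1 (by omega), List.ofFn_succ, dynkin_word_cons]
  simp

end DynkinElement

/-! ### Elements acting on separate blocks -/

section Blocks

variable {F : Type*} [CommRing F] {X : Type*} {n : ℕ} (q : Composition n)

theorem embedding_lt_embedding {i j : Fin q.length} (h : i < j) (a : Fin (q.blocksFun i))
    (b : Fin (q.blocksFun j)) : q.embedding i a < q.embedding j b := by
  have h1 := (q.mem_range_embedding_iff.1 ⟨a, rfl⟩ :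
    q.sizeUpTo i ≤ q.embedding i a ∧ (q.embedding i a : ℕ) < q.sizeUpTo (i : ℕ).succ).2
  have h2 : q.sizeUpTo (i : ℕ).succ ≤ q.sizeUpTo j := q.monotone_sizeUpTo (Nat.succ_le_of_lt h)
  rw [Fin.lt_def, q.coe_embedding j b]
  omega

theorem flatten_ofFn_embedding :
    (List.ofFn fun j => List.ofFn (q.embedding j)).flatten = List.finRange n := by
  refine List.SortedLT.eq_of_mem_iff (List.Pairwise.sortedLT ?_) (List.sortedLT_finRange n) ?_
  · rw [List.pairwise_flatten]
    refine ⟨?_, ?_⟩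
    · intro l hl
      obtain ⟨j, rfl⟩ := (List.mem_ofFn' _ _).1 hl
      rw [List.pairwise_ofFn]
      exact fun a b h => (q.embedding j).strictMono h
    · rw [List.pairwise_ofFn]
      intro i j hij a ha b hb
      obtain ⟨a, rfl⟩ := (List.mem_ofFn' _ _).1 ha
      obtain ⟨b, rfl⟩ := (List.mem_ofFn' _ _).1 hb
      exact embedding_lt_embedding q hij a b
  · intro a
    simp only [List.mem_flatten, List.mem_ofFn', List.mem_finRange, iff_true]
    exact ⟨_, ⟨q.index a, rfl⟩, (List.mem_ofFn' _ _).2 (q.mem_range_embedding a)⟩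

theorem word_ofFn_eq_prod_blocks (h : Fin n → X) :
    word F (List.ofFn h) = (List.ofFn fun j => word F (List.ofFn (h ∘ q.embedding j))).prod := by
  rw [List.ofFn_eq_map, ← flatten_ofFn_embedding q, List.map_flatten, word_flatten,
    List.map_ofFn, List.map_ofFn]
  simp only [Function.comp_def, List.map_ofFn]

theorem prod_viaEmbedding_embedding (σ : ∀ j, Equiv.Perm (Fin (q.blocksFun j)))
    (l : List (Fin q.length)) (hl : l.Nodup) (j : Fin q.length) (a : Fin (q.blocksFun j)) :
    (l.map fun i => Equiv.Perm.viaEmbeddingHom (q.embedding i).toEmbedding (σ i)).prod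
      (q.embedding j a) = if j ∈ l then q.embedding j (σ j a) else q.embedding j a := by
  induction l with
  | nil => simp
  | cons i l ih =>
    rw [List.nodup_cons] at hl
    rw [List.map_cons, List.prod_cons, Equiv.Perm.mul_apply, ih hl.2,
      Equiv.Perm.viaEmbeddingHom_apply]
    rcases eq_or_ne j i with rfl | hij
    · rw [if_neg hl.1, if_pos List.mem_cons_self]
      exact Equiv.Perm.viaEmbedding_apply (σ j) (q.embedding j).toEmbedding a
    · have h1 : ∀ b, q.embedding j b ∉ Set.range (q.embedding i).toEmbedding := fun b hb => by
        have := q.mem_range_embedding_iff'.1 hb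
        rw [q.index_embedding] at this
        exact hij this.symm
      simp only [List.mem_cons, hij, false_or]
      split_ifs <;> exact Equiv.Perm.viaEmbedding_apply_of_notMem _ _ _ (h1 _)

/-- Elements acting on the separate blocks transform the corresponding subwords. -/
theorem wordMap_prod_blocks (a : ∀ j, SymAlg F (q.blocksFun j)) (h : Fin n → X) :
    wordMap h (List.ofFn fun j : Fin q.length => MonoidAlgebra.mapDomainAlgHom F F
      (Equiv.Perm.viaEmbeddingHom (q.embedding j).toEmbedding) (a j)).prod =
    (List.ofFn fun j => wordMap (h ∘ q.embedding j) (a j)).prod := by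
  have key : (wordMap h).compMultilinearMap
      ((MultilinearMap.mkPiAlgebraFin F q.length (SymAlg F n)).compLinearMap fun j =>
        (MonoidAlgebra.mapDomainAlgHom F F
          (Equiv.Perm.viaEmbeddingHom (q.embedding j).toEmbedding)).toLinearMap) =
      (MultilinearMap.mkPiAlgebraFin F q.length (WordAlg F X)).compLinearMap fun j =>
        wordMap (F := F) (h ∘ q.embedding j) := by
    refine Basis.ext_multilinear (fun j => monomialBasis F _) fun σ => ?_
    set τ := (List.ofFn fun i => Equiv.Perm.viaEmbeddingHom (q.embedding i).toEmbedding (σ i)).prod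
      with hτ
    have h1 : (List.ofFn fun j => (MonoidAlgebra.single
        (Equiv.Perm.viaEmbeddingHom (q.embedding j).toEmbedding (σ j)) 1 : SymAlg F n)).prod =
        MonoidAlgebra.single τ 1 := by
      rw [hτ, ← MonoidAlgebra.of_apply, map_list_prod, List.map_ofFn]
      rfl
    have h2 : ∀ j, (h ∘ τ) ∘ q.embedding j = (h ∘ q.embedding j) ∘ σ j := by
      intro j
      funext b
      have := prod_viaEmbedding_embedding q σ _ (List.nodup_finRange _) j b
      rw [if_pos (List.mem_finRange j), ← List.ofFn_eq_map, ← hτ] at this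
      simp [this]
    simp only [LinearMap.compMultilinearMap_apply, MultilinearMap.compLinearMap_apply,
      MultilinearMap.mkPiAlgebraFin_apply, monomialBasis_apply, AlgHom.toLinearMap_apply,
      MonoidAlgebra.mapDomainAlgHom_apply, MonoidAlgebra.mapDomain_single, h1, wordMap_single]
    rw [word_ofFn_eq_prod_blocks q]
    simp only [h2]
  simpa using DFunLike.congr_fun key a

theorem wordMap_omegaUp (h : Fin n → X) :
    wordMap h (omegaUp F q) =
      (List.ofFn fun j => dynkin (word F (List.ofFn (h ∘ q.embedding j)))).prod := by
  rw [omegaUp, wordMap_prod_blocks]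
  simp only [wordMap_omega (q.one_le_blocksFun _)]

end Blocks

/-! ### Descent classes as convolutions -/

section Descents

variable {F : Type*} [CommRing F] {X : Type*} {n : ℕ} (q : Composition n)

theorem strictMono_of_lt_succ {b : ℕ} {α : Type*} [Preorder α] {f : Fin b → α}
    (h : ∀ (i : ℕ) (hi : i + 1 < b), f ⟨i, Nat.lt_of_succ_lt hi⟩ < f ⟨i + 1, hi⟩) :
    StrictMono f := by
  obtain _ | b := b
  · exact fun i => i.elim0
  · exact Fin.strictMono_iff_lt_succ.2 fun i => h i (by omega)

/-- The descents of `σ` are partial sums of `q` if and only if `σ` increases on the blocks. -/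
theorem descentSet_subset_iff (σ : Equiv.Perm (Fin n)) :
    descentSet σ ⊆ partialSums q ↔ ∀ j, StrictMono (σ ∘ q.embedding j) := by
  constructor
  · intro h j
    refine strictMono_of_lt_succ fun i hi => ?_
    have hlt : q.sizeUpTo j + i + 1 < n := by
      have := (q.embedding j ⟨i + 1, hi⟩).2
      rw [q.coe_embedding] at this
      exact this
    have e1 : q.embedding j ⟨i, Nat.lt_of_succ_lt hi⟩ =
      ⟨q.sizeUpTo j + i, Nat.lt_of_succ_lt hlt⟩ := rfl
    have e2 : q.embedding j ⟨i + 1, hi⟩ = ⟨q.sizeUpTo j + i + 1, hlt⟩ := rfl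
    rw [Function.comp_apply, Function.comp_apply, e1, e2]
    refine lt_of_le_of_ne (not_lt.1 fun hd => ?_) (fun he => by simpa using σ.injective he)
    -- The descent would be a partial sum strictly between `q.sizeUpTo j` and `q.sizeUpTo (j + 1)`.
    obtain ⟨t, -, -, ht⟩ := h ⟨_, hlt, rfl, hd⟩
    have hs := q.sizeUpTo_succ' j
    rcases le_or_gt t j with htj | htj
    · have := q.monotone_sizeUpTo htj
      omega
    · have := q.monotone_sizeUpTo (Nat.succ_le_of_lt htj)
      rw [Nat.succ_eq_add_one] at this
      omega
  · rintro h _ ⟨i, hi, rfl, hd⟩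
    set p : Fin n := ⟨i, Nat.lt_of_succ_lt hi⟩ with hp
    have hlo := q.sizeUpTo_index_le p
    have hup := q.lt_sizeUpTo_index_succ p
    rw [Fin.val_succ] at hup
    have hpv : (p : ℕ) = i := rfl
    -- The candidate is the end of the block containing `p`. If the descent is not there, both its
    -- positions lie in this block, where `σ` increases.
    refine ⟨q.index p + 1, by omega, by omega, ?_⟩
    by_contra hne
    obtain ⟨a, ha⟩ : p ∈ Set.range (q.embedding (q.index p)) := q.mem_range_embedding p
    obtain ⟨b, hb⟩ : (⟨i + 1, hi⟩ : Fin n) ∈ Set.range (q.embedding (q.index p)) := by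
      rw [q.mem_range_embedding_iff]
      simp only [Nat.succ_eq_add_one]
      omega
    have hab : a < b := by
      rw [← (q.embedding (q.index p)).lt_iff_lt, ha, hb, hp, Fin.lt_def]
      simp
    have := h _ hab
    rw [Function.comp_apply, Function.comp_apply, ha, hb] at this
    exact lt_asymm this hd

/-- Both lists are strictly increasing and have the same members, the letters in block `j` of the
word `σ`. -/
theorem filter_index_symm_eq {σ : Equiv.Perm (Fin n)} {j : Fin q.length}
    (hσ : StrictMono (σ ∘ q.embedding j)) :
    (List.finRange n).filter (fun a => q.index (σ.symm a) = j) = List.ofFn (σ ∘ q.embedding j) := by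
  refine List.SortedLT.eq_of_mem_iff
    (List.Pairwise.sortedLT ((List.sortedLT_finRange n).pairwise.filter _))
    (List.Pairwise.sortedLT (List.pairwise_ofFn.2 fun a b h => hσ h)) fun a => ?_
  simp only [List.mem_filter, List.mem_finRange, decide_eq_true_eq, true_and, List.mem_ofFn',
    Set.range_comp]
  rw [Set.mem_image_equiv, q.mem_range_embedding_iff', eq_comm]

/-- A distribution of the letters to the blocks with the right sizes comes from a permutation that
increases on the blocks. -/
theorem exists_perm_of_length_filter (f : Fin n → Fin q.length)
    (hf : ∀ j, ((List.finRange n).filter (f · = j)).length = q.blocksFun j) :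
    ∃ σ : Equiv.Perm (Fin n), (∀ j, StrictMono (σ ∘ q.embedding j)) ∧
      (fun i => q.index (σ.symm i)) = f := by
  -- Place `a` of block `j` receives the `a`-th smallest letter assigned to `j`.
  let e : (Σ j : Fin q.length, Fin (q.blocksFun j)) → Fin n := fun x =>
    ((List.finRange n).filter (f · = x.1)).get (x.2.cast (hf x.1).symm)
  have hmem : ∀ x, f (e x) = x.1 := fun x => by
    have := List.get_mem ((List.finRange n).filter (f · = x.1)) (x.2.cast (hf x.1).symm)
    exact of_decide_eq_true (List.mem_filter.1 this).2
  have hmono : ∀ j, StrictMono fun a => e ⟨j, a⟩ := fun j a b hab =>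
    ((List.sortedLT_finRange n).pairwise.filter _).sortedLT.strictMono_get (by simpa using hab)
  have hinj : Function.Injective e := by
    rintro ⟨i, a⟩ ⟨j, b⟩ h
    obtain rfl : i = j := (hmem ⟨i, a⟩).symm.trans ((congrArg f h).trans (hmem ⟨j, b⟩))
    rw [(hmono i).injective h]
  have hbij : Function.Bijective (e ∘ q.blocksFinEquiv.symm) :=
    Finite.injective_iff_bijective.1 (hinj.comp (Equiv.injective _))
  have hσ : ∀ j a, Equiv.ofBijective _ hbij (q.embedding j a) = e ⟨j, a⟩ := fun j a => by
    have : q.blocksFinEquiv.symm (q.embedding j a) = ⟨j, a⟩ :=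
      q.blocksFinEquiv.symm_apply_apply ⟨j, a⟩
    simp [this]
  refine ⟨Equiv.ofBijective _ hbij, fun j => ?_, ?_⟩
  · convert hmono j using 1
    funext a
    exact hσ j a
  · funext i
    obtain ⟨p, rfl⟩ := (Equiv.ofBijective _ hbij).surjective i
    rw [Equiv.symm_apply_apply]
    conv_rhs => rw [← q.embedding_comp_inv p, hσ, hmem]

open Classical in
/-- A convolution of homogeneous maps as a sum over permutations that increase on the blocks. -/
theorem convolution_word_eq_sum_descents (G : Fin q.length → WordAlg F X →ₗ[F] WordAlg F X)
    (hG : ∀ j (w : List X), w.length ≠ q.blocksFun j → G j (word F w) = 0) (h : Fin n → X) :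
    convolution G (word F (List.ofFn h)) =
      ∑ σ : Equiv.Perm (Fin n) with descentSet σ ⊆ partialSums q,
        (List.ofFn fun j => G j (word F (List.ofFn (h ∘ σ ∘ q.embedding j)))).prod := by
  rw [convolution_word]
  symm
  refine Finset.sum_of_injOn (fun σ i => q.index (σ.symm i)) ?_ (by simp) ?_ ?_
  · intro σ hσ τ hτ hστ
    simp only [Finset.coe_filter, Finset.mem_univ, true_and, Set.mem_ofPred_eq,
      descentSet_subset_iff] at hσ hτ
    ext1 p
    rw [← q.embedding_comp_inv p]
    have h1 := filter_index_symm_eq q (hσ (q.index p))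
    rw [funext_iff] at hστ
    simp only at hστ
    simp only [hστ, filter_index_symm_eq q (hτ (q.index p))] at h1
    exact (congrFun (List.ofFn_injective h1) (q.invEmbedding p)).symm
  · intro f _ hf
    by_cases hl : ∀ j, ((List.finRange n).filter (f · = j)).length = q.blocksFun j
    · obtain ⟨σ, hσ, hσf⟩ := exists_perm_of_length_filter q f hl
      exact absurd ⟨σ, by simpa [descentSet_subset_iff] using hσ, hσf⟩ hf
    · push Not at hl
      obtain ⟨j, hj⟩ := hl
      exact prod_ofFn_eq_zero (F := F) (j := j) (hG j _ (by simpa using hj))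
  · intro σ hσ
    simp only [Finset.mem_filter, Finset.mem_univ, true_and, descentSet_subset_iff] at hσ
    congr 2
    funext j
    rw [filter_index_symm_eq q (hσ j), List.map_ofFn]

theorem wordMap_Xi (h : Fin n → X) :
    wordMap h (Xi F q) = degConv q.blocksFun (word F (List.ofFn h)) := by
  rw [degConv, convolution_word_eq_sum_descents q _ fun j w hw => by rw [degProj_word, if_neg hw],
    Xi, map_sum]
  refine Finset.sum_congr rfl fun σ _ => ?_
  rw [MonoidAlgebra.of_apply, wordMap_single, word_ofFn_eq_prod_blocks q]
  congr 2
  funext j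
  rw [degProj_word, if_pos (by simp)]
  rfl

/-- `Xi` selects the ways to split the word into subwords of the block lengths, and `omegaUp` then
brackets each subword: this is the convolution of the Dynkin operators. -/
theorem wordMap_omegaLow (h : Fin n → X) :
    wordMap h (omegaLow F q) = dynkinConv q.blocksFun (word F (List.ofFn h)) := by
  rw [dynkinConv, convolution_word_eq_sum_descents q _ fun j w hw => by
    rw [dynkinProj_word, if_neg hw], omegaLow, Xi, Finset.sum_mul, map_sum]
  refine Finset.sum_congr rfl fun σ _ => ?_
  rw [MonoidAlgebra.of_apply, wordMap_single_mul, wordMap_omegaUp]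
  congr 2
  funext j
  rw [dynkinProj_word, if_pos (by simp)]
  rfl

theorem wordMap_mul_Xi (h : Fin n → X) (a : SymAlg F n) :
    wordMap h (a * Xi F q) = degConv q.blocksFun (wordMap h a) :=
  wordMap_mul_eq (wordMap_Xi q) h a

theorem wordMap_mul_omegaLow (h : Fin n → X) (a : SymAlg F n) :
    wordMap h (a * omegaLow F q) = dynkinConv q.blocksFun (wordMap h a) :=
  wordMap_mul_eq (wordMap_omegaLow q) h a

end Descents

/-! ### Weak refinements and distributions of parts -/

section Refinement

variable {n : ℕ}

/-- Parts may repeat, so a rearrangement of the values has to be lifted to one of the indices. -/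
theorem exists_perm_map_eq {ι : Type*} {d : ι → ℕ} {v : List ℕ} :
    ∀ {l : List ι}, (l.map d).Perm v → ∃ l' : List ι, l'.Perm l ∧ l'.map d = v := by
  induction v with
  | nil => intro l h; exact ⟨[], by simpa using h.eq_nil, rfl⟩
  | cons x v ih =>
    intro l h
    obtain ⟨i, hi, rfl⟩ := List.mem_map.1 (h.mem_iff.2 List.mem_cons_self)
    obtain ⟨l₁, l₂, rfl⟩ := List.append_of_mem hi
    have h' : ((l₁ ++ l₂).map d).Perm v := by
      rw [← List.perm_cons (d i)]
      refine List.Perm.trans ?_ h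
      exact (List.perm_middle.symm.map d)
    obtain ⟨l', hl', rfl⟩ := ih h'
    exact ⟨i :: l', (hl'.cons i).trans List.perm_middle.symm, rfl⟩

/-- If the values of `d` can be cut into the pieces `L`, then the indices can be distributed. -/
theorem exists_distribution {ι : Type*} [DecidableEq ι] {d : ι → ℕ} (L : List (List ℕ)) :
    ∀ l : List ι, l.Nodup → l.map d = L.flatten → ∃ f : ι → ℕ, (∀ i ∈ l, f i < L.length) ∧
      ∀ (j : ℕ) (h : j < L.length), ((l.filter (f · = j)).map d).sum = L[j].sum := by
  induction L with
  | nil =>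
    intro l _ h
    obtain rfl : l = [] := by simpa using h
    exact ⟨fun _ => 0, by simp, by simp⟩
  | cons a L ih =>
    intro l hl h
    rw [List.flatten_cons, List.map_eq_append_iff] at h
    obtain ⟨l₁, l₂, rfl, rfl, h₂⟩ := h
    rw [List.nodup_append'] at hl
    obtain ⟨hn₁, hn₂, hd⟩ := hl
    obtain ⟨f, hf, hs⟩ := ih l₂ hn₂ h₂
    -- The first piece takes slot `0`; the slots of the other pieces shift by one.
    refine ⟨fun i => if i ∈ l₁ then 0 else f i + 1, fun i hi => ?_, fun j hj => ?_⟩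
    · by_cases h1 : i ∈ l₁
      · simp [h1]
      · simpa [h1] using hf i ((List.mem_append.1 hi).resolve_left h1)
    · have e1 : ∀ j, l₁.filter (fun i => (if i ∈ l₁ then 0 else f i + 1) = j) =
          if j = 0 then l₁ else [] := by
        intro j
        split_ifs with h0
        · exact List.filter_eq_self.2 fun i hi => by simp [hi, h0]
        · exact List.filter_eq_nil_iff.2 fun i hi => by simpa [hi] using Ne.symm h0
      have e2 : ∀ j, l₂.filter (fun i => (if i ∈ l₁ then 0 else f i + 1) = j) =
          l₂.filter (f · + 1 = j) := by
        intro j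
        exact List.filter_congr fun i hi => by rw [if_neg fun h => hd h hi]
      rw [List.filter_append, e1, e2]
      obtain _ | j := j
      · simp
      · simpa using hs j (by simpa using hj)

/-- The pieces of a rearrangement are the fibres of a distribution; conversely, concatenating the
fibres gives the rearrangement. This turns the combinatorial condition into the nonvanishing of a
coefficient. -/
theorem isWeakRefinement_iff (r q : Composition n) :
    IsWeakRefinement r q ↔ (distributions r.blocksFun q.blocksFun).Nonempty := by
  constructor
  · rintro ⟨s, hrs, L, hL, hq⟩
    have hr : (List.finRange r.length).map r.blocksFun = r.blocks := by
      rw [← List.ofFn_eq_map, r.ofFn_blocksFun]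
    obtain ⟨l, hl, hls⟩ := exists_perm_map_eq (d := r.blocksFun) (l := List.finRange r.length)
      (v := s.blocks) (by rwa [hr])
    obtain ⟨f, hf, hs⟩ := exists_distribution L l (hl.nodup_iff.2 (List.nodup_finRange _))
      (hls.trans hL.symm)
    have hlen : L.length = q.length := by
      rw [← List.length_map (f := List.sum), hq, q.blocks_length]
    refine ⟨fun i => ⟨f i, hlen ▸ hf i (hl.mem_iff.2 (List.mem_finRange i))⟩, ?_⟩
    simp only [distributions, Finset.mem_filter, Finset.mem_univ, true_and]
    intro j
    have h1 := hs j (by rw [hlen]; exact j.2)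
    have h2 : (L[(j : ℕ)]'(by rw [hlen]; exact j.2)).sum = q.blocksFun j := by
      simp only [Composition.blocksFun, List.get_eq_getElem, ← hq, List.getElem_map]
    rw [← h2, ← h1]
    simp only [Fin.ext_iff]
    exact ((hl.symm.filter _).map _).sum_eq
  · rintro ⟨f, hf⟩
    simp only [distributions, Finset.mem_filter, Finset.mem_univ, true_and] at hf
    set L : List (List ℕ) := List.ofFn fun j =>
      ((List.finRange r.length).filter (f · = j)).map r.blocksFun with hL
    have hp : r.blocks.Perm L.flatten := by
      have h := (flatten_filter_perm (List.nodup_finRange r.length) f).map r.blocksFun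
      rw [← List.ofFn_eq_map, r.ofFn_blocksFun, List.map_flatten, List.map_ofFn] at h
      exact h.symm
    refine ⟨⟨L.flatten, fun {i} hi => r.blocks_pos (hp.mem_iff.2 hi), by
      rw [← hp.sum_eq, r.blocks_sum]⟩, hp, L, rfl, ?_⟩
    rw [hL, List.map_ofFn, ← q.ofFn_blocksFun]
    congr 1
    funext j
    exact hf j

theorem IsPartition.eq_of_perm {r s : Composition n} (hr : IsPartition r) (hs : IsPartition s)
    (h : r.blocks.Perm s.blocks) : r = s :=
  Composition.ext (h.eq_of_sortedGE (List.Pairwise.sortedGE hr) (List.Pairwise.sortedGE hs))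

end Refinement

/-! ### Triangular decompositions of left ideals, and multiplicities -/

section Modules

/-- If the left ideals generated by the `e i` span the ring, if `x` annihilates those outside `J`
and acts triangularly on the others with nonzero diagonal, then the left ideal generated by `x` is
isomorphic to the direct sum of the left ideals generated by the `e i` for `i ∈ J`. -/
theorem nonempty_span_equiv_directSum {F A ι : Type*} [Field F] [Ring A] [Algebra F A]
    (e : ι → A) (x : A) (ℓ : ι → ℕ) (K : ι → Prop) (J : Finset ι) (φ : ι → F)
    (hne : ∀ i ∈ J, ∀ j ∈ J, j ≠ i → ℓ j ≤ ℓ i → e j * x * e i = 0)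
    (hself : ∀ i ∈ J, e i * x * e i = φ i • e i) (hφ : ∀ i ∈ J, φ i ≠ 0)
    (hzero : ∀ i, K i → i ∉ J → e i * x = 0)
    (htop : (⨆ (i) (_ : K i), Submodule.span A {e i}) = ⊤) :
    Nonempty (Submodule.span A {x} ≃ₗ[A] ⨁ i : {i // i ∈ J}, Submodule.span A {e i.1}) := by
  classical
  let g : (⨁ i : {i // i ∈ J}, Submodule.span A {e i.1}) →ₗ[A] A :=
    DirectSum.toModule A _ _ fun i =>
      LinearMap.toSpanSingleton A A x ∘ₗ (Submodule.span A {e i.1}).subtype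
  have hg : ∀ v, g v = ∑ i, (v i : A) * x := by
    intro v
    conv_lhs => rw [← DirectSum.sum_univ_of v, map_sum]
    refine Finset.sum_congr rfl fun i _ => ?_
    exact DirectSum.toModule_lof (M := fun i : {i // i ∈ J} => Submodule.span A {e i.1}) A i (v i)
  have hinj : Function.Injective g := by
    rw [injective_iff_map_eq_zero]
    intro v hv
    by_contra hne0
    have hs : (Finset.univ.filter fun i => v i ≠ 0).Nonempty := by
      by_contra h
      rw [Finset.not_nonempty_iff_eq_empty, Finset.filter_eq_empty_iff] at h
      exact hne0 (DFinsupp.ext fun i => not_not.1 (h (Finset.mem_univ i)))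
    -- Right multiplication by `e i`, with `ℓ i` maximal among the nonzero components, annihilates
    -- every other component of the relation and leaves `φ i • v i`.
    obtain ⟨i, hi, hmax⟩ := Finset.exists_max_image _ (fun i : {i // i ∈ J} => ℓ i.1) hs
    simp only [Finset.mem_filter, Finset.mem_univ, true_and] at hi hmax
    have h0 : ∑ j, (v j : A) * x * e i.1 = 0 := by
      rw [← Finset.sum_mul, ← hg, hv, zero_mul]
    rw [Finset.sum_eq_single i] at h0
    · obtain ⟨b, hb⟩ := Submodule.mem_span_singleton.1 (v i).2
      rw [← hb, smul_eq_mul, mul_assoc, mul_assoc, ← mul_assoc (e i.1), hself i.1 i.2,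
        mul_smul_comm, ← smul_eq_mul, hb, smul_eq_zero] at h0
      exact hi (Subtype.ext (h0.resolve_left (hφ i.1 i.2)))
    · intro j _ hji
      by_cases hvj : v j = 0
      · simp [hvj]
      · obtain ⟨b, hb⟩ := Submodule.mem_span_singleton.1 (v j).2
        rw [← hb, smul_eq_mul, mul_assoc, mul_assoc, ← mul_assoc (e j.1),
          hne i.1 i.2 j.1 j.2 (fun h => hji (Subtype.ext h)) (hmax j hvj), mul_zero]
    · simp
  have hrange : LinearMap.range g = Submodule.span A {x} := by
    refine le_antisymm ?_ ?_
    · rintro _ ⟨v, rfl⟩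
      rw [hg]
      exact Submodule.sum_mem _ fun i _ =>
        Submodule.smul_mem _ _ (Submodule.mem_span_singleton_self x)
    -- It suffices that right multiplication by `x` sends each generator `e i` into the range,
    -- because these generate the ring and in particular `1`.
    · have h : (⨆ (i) (_ : K i), Submodule.span A {e i}) ≤
          (LinearMap.range g).comap (LinearMap.toSpanSingleton A A x) := by
        refine iSup₂_le fun i hi => ?_
        rw [Submodule.span_singleton_le_iff_mem, Submodule.mem_comap,
          LinearMap.toSpanSingleton_apply, smul_eq_mul]
        by_cases hJ : i ∈ J
        · exact ⟨DirectSum.lof A _ _ ⟨i, hJ⟩ ⟨e i, Submodule.mem_span_singleton_self _⟩,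
            DirectSum.toModule_lof A _ _⟩
        · rw [hzero i hi hJ]
          exact zero_mem _
      rw [htop] at h
      rw [Submodule.span_singleton_le_iff_mem]
      simpa using h (Submodule.mem_top (x := 1))
  exact ⟨((LinearEquiv.ofInjective g hinj).trans (LinearEquiv.ofEq _ _ hrange)).symm⟩

/-- Multiplicities are additive in direct sums. -/
theorem multiplicity_eq_sum {A S M ι : Type*} [Ring A] [AddCommGroup S] [Module A S]
    [IsSimpleModule A S] [AddCommGroup M] [Module A M] [Fintype ι] {N : ι → Type*}
    [∀ i, AddCommGroup (N i)] [∀ i, Module A (N i)] (e : M ≃ₗ[A] ⨁ i, N i) :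
    multiplicity A S M = ∑ i, multiplicity A S (N i) := by
  classical
  -- Homomorphisms respect isotypic components, so projections and inclusions of the direct sum
  -- restrict to them.
  let p : ∀ i, M →ₗ[A] N i := fun i => DirectSum.component A ι N i ∘ₗ e.toLinearMap
  let g : isotypicComponent A M S →ₗ[A] ∀ i, isotypicComponent A (N i) S :=
    LinearMap.pi fun i => (p i).restrict (p := isotypicComponent A M S)
      (q := isotypicComponent A (N i) S) (LinearMap.le_comap_isotypicComponent S (p i))
  have hg : ∀ v i, (g v i : N i) = e v i := fun v i => rfl
  have hbij : Function.Bijective g := by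
    constructor
    · rw [injective_iff_map_eq_zero]
      intro v hv
      refine Subtype.ext (e.injective (DFinsupp.ext fun i => ?_))
      have := hg v i
      rw [hv] at this
      simpa using this.symm
    · intro y
      have hmem : e.symm (∑ i, DirectSum.lof A ι N i (y i)) ∈ isotypicComponent A M S := by
        rw [map_sum]
        exact Submodule.sum_mem _ fun i _ => LinearMap.le_comap_isotypicComponent S
          (e.symm.toLinearMap ∘ₗ DirectSum.lof A ι N i) (y i).2
      refine ⟨⟨_, hmem⟩, funext fun i => Subtype.ext ?_⟩
      rw [hg]
      simp only [LinearEquiv.apply_symm_apply]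
      have h := DirectSum.sum_univ_of (β := N) (DirectSum.mk N Finset.univ fun i => (y i : N i))
      have h2 : ∀ i, DirectSum.mk N Finset.univ (fun i => (y i : N i)) i = y i := fun i => by
        simp [DirectSum.mk]
      simp only [h2] at h
      rw [← h2 i, ← h]
      rfl
  rw [multiplicity, (LinearEquiv.ofBijective g hbij).length_eq, Module.length_pi_of_fintype]
  rfl

end Modules

/-! ### Products of higher Lie elements with descent elements -/

section Main

variable {F : Type*} [CommRing F] {n : ℕ}

/-- The rightmost factor acts last. Partitions that differ are not rearrangements of each other, so
the degrees do not match. -/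
theorem omegaLow_mul_Xi_mul_omegaLow_of_ne (q : Composition n) {r s : Composition n}
    (hr : IsPartition r) (hs : IsPartition s) (hrs : r ≠ s) (hlen : r.length ≤ s.length) :
    omegaLow F r * Xi F q * omegaLow F s = 0 := by
  apply wordMap_injective
  rw [wordMap_mul_omegaLow, wordMap_mul_Xi, wordMap_omegaLow,
    dynkinConv_degConv_dynkinConv_of_ne q.blocksFun s.one_le_blocksFun r.one_le_blocksFun hlen,
    map_zero]
  rw [r.ofFn_blocksFun, s.ofFn_blocksFun]
  exact fun h => hrs (hr.eq_of_perm hs h)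

theorem omegaLow_mul_Xi_mul_omegaLow_self (q r : Composition n) :
    omegaLow F r * Xi F q * omegaLow F r =
      (((distributions r.blocksFun q.blocksFun).card : F) * dynkinScalar F r.blocksFun) •
        omegaLow F r := by
  apply wordMap_injective
  rw [wordMap_mul_omegaLow, wordMap_mul_Xi, map_smul, wordMap_omegaLow,
    dynkinConv_degConv_dynkinConv_self q.blocksFun r.one_le_blocksFun]

theorem omegaLow_mul_Xi_eq_zero {q r : Composition n} (h : ¬ IsWeakRefinement r q) :
    omegaLow F r * Xi F q = 0 := by
  apply wordMap_injective
  rw [isWeakRefinement_iff, Finset.not_nonempty_iff_eq_empty] at h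
  rw [wordMap_mul_Xi, map_zero, wordMap_omegaLow]
  exact degConv_eq_zero_of_mem_lieProducts h
    (dynkinConv_mem_lieProducts _ r.one_le_blocksFun _)

/-- On the word of a permutation this is a left multiple of `omegaLow F r`; all other words
contribute zero. -/
theorem permProj_dynkinConv_mem (r : Composition n) (x : WordAlg F (Fin n)) :
    permProj F n (dynkinConv r.blocksFun x) ∈ LieModule F r := by
  have h : Submodule.span F (Set.range (word F : List (Fin n) → WordAlg F (Fin n))) ≤
      ((LieModule F r).restrictScalars F).comap (permProj F n ∘ₗ dynkinConv r.blocksFun) := by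
    rw [Submodule.span_le]
    rintro _ ⟨w, rfl⟩
    obtain ⟨m, h, rfl⟩ : ∃ (m : ℕ) (h : Fin m → Fin n), w = List.ofFn h := ⟨_, w.get, by simp⟩
    rw [SetLike.mem_coe, Submodule.mem_comap, Submodule.restrictScalars_mem,
      LinearMap.comp_apply]
    rcases eq_or_ne m n with rfl | hmn
    · rw [← wordMap_omegaLow]
      by_cases hb : Function.Bijective h
      · have := permProj_wordMap_perm (Equiv.ofBijective h hb) (omegaLow F r)
        rw [show ⇑(Equiv.ofBijective h hb) = h from rfl] at this
        rw [this]
        exact Submodule.smul_mem _ _ (Submodule.mem_span_singleton_self _)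
      · rw [permProj_wordMap_of_not_bijective hb]
        exact zero_mem _
    -- A word of length other than `n` cannot be distributed with all block lengths correct, as
    -- these add up to `n`.
    · convert zero_mem (LieModule F r)
      rw [dynkinConv, convolution_word, Finset.sum_eq_zero, map_zero]
      intro f _
      have hf : ∃ j, ((List.finRange m).filter (f · = j)).length ≠ r.blocksFun j := by
        by_contra! hall
        have h1 := (flatten_filter_perm (List.nodup_finRange m) f).length_eq
        rw [List.length_flatten, List.map_ofFn, List.length_finRange, List.sum_ofFn] at h1
        simp only [Function.comp_apply, hall, r.sum_blocksFun] at h1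
        exact hmn h1.symm
      obtain ⟨j, hj⟩ := hf
      refine prod_ofFn_eq_zero (F := F) (j := j) ?_
      rw [dynkinProj_word, if_neg (by simpa using hj)]
  rw [span_range_word] at h
  exact h (Submodule.mem_top (x := x))

/-- The word of the identity permutation lies in `dynkinSpan`; projecting back to the group algebra
puts `1` into the sum. -/
theorem iSup_lieModule_eq_top {F : Type*} [Field F] [CharZero F] {n : ℕ} :
    (⨆ (r : Composition n) (_ : IsPartition r), LieModule F r) = ⊤ := by
  set U : Submodule (SymAlg F n) (SymAlg F n) :=
    ⨆ (r : Composition n) (_ : IsPartition r), LieModule F r with hU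
  have h : dynkinSpan F (Fin n) n ≤ (U.restrictScalars F).comap (permProj F n) := by
    refine iSup₂_le fun r hr => ?_
    rintro _ ⟨x, rfl⟩
    exact Submodule.mem_iSup_of_mem r (Submodule.mem_iSup_of_mem hr (permProj_dynkinConv_mem r x))
  have h1 := word_mem_dynkinSpan (F := F) (List.ofFn (id : Fin n → Fin n))
  rw [List.length_ofFn] at h1
  have h2 := h h1
  rw [Submodule.mem_comap, ← wordMap_one, permProj_wordMap] at h2
  exact (Ideal.eq_top_iff_one U).2 h2

end Main

end HigherLie
end

theorem theoremT {F : Type*} [Field F] [CharZero F] {n : ℕ} (q : Composition n) :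
    Nonempty (HigherLie.XiModule F q ≃ₗ[HigherLie.SymAlg F n]
      ⨁ l : {l // l ∈ HigherLie.weakRefiningPartitions q}, HigherLie.LieModule F l.1) ∧
    ∀ (S : Type*) [AddCommGroup S] [Module (HigherLie.SymAlg F n) S]
      [IsSimpleModule (HigherLie.SymAlg F n) S],
      HigherLie.multiplicity (HigherLie.SymAlg F n) S (HigherLie.XiModule F q) =
        ∑ l ∈ HigherLie.weakRefiningPartitions q,
          HigherLie.multiplicity (HigherLie.SymAlg F n) S (HigherLie.LieModule F l) := by
  have hmem : ∀ l : Composition n, l ∈ HigherLie.weakRefiningPartitions q ↔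
      HigherLie.IsPartition l ∧ HigherLie.IsWeakRefinement l q := fun l => by
    simp [HigherLie.weakRefiningPartitions]
  have h : Nonempty (HigherLie.XiModule F q ≃ₗ[HigherLie.SymAlg F n]
      ⨁ l : {l // l ∈ HigherLie.weakRefiningPartitions q}, HigherLie.LieModule F l.1) := by
    -- The triangular order is by number of parts; the diagonal entry is the number of distributions
    -- times `dynkinScalar`.
    refine HigherLie.nonempty_span_equiv_directSum (F := F) (fun l => HigherLie.omegaLow F l)
      (HigherLie.Xi F q) Composition.length HigherLie.IsPartition _ _ ?_
      (fun r _ => HigherLie.omegaLow_mul_Xi_mul_omegaLow_self q r) ?_ ?_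
      HigherLie.iSup_lieModule_eq_top
    · intro r hr s hs hsr hlen
      exact HigherLie.omegaLow_mul_Xi_mul_omegaLow_of_ne q ((hmem s).1 hs).1 ((hmem r).1 hr).1
        hsr hlen
    · intro r hr
      refine mul_ne_zero (Nat.cast_ne_zero.2 ?_)
        (HigherLie.dynkinScalar_ne_zero r.one_le_blocksFun)
      exact (Finset.card_pos.2
        ((HigherLie.isWeakRefinement_iff r q).1 ((hmem r).1 hr).2)).ne'
    · intro r hr hrJ
      exact HigherLie.omegaLow_mul_Xi_eq_zero fun hw => hrJ ((hmem r).2 ⟨hr, hw⟩)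
  refine ⟨h, ?_⟩
  intro S _ _ _
  obtain ⟨e⟩ := h
  rw [HigherLie.multiplicity_eq_sum e]
  exact Finset.sum_coe_sort (HigherLie.weakRefiningPartitions q) fun l =>
    HigherLie.multiplicity (HigherLie.SymAlg F n) S (HigherLie.LieModule F l)
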